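/- Let $\mathbf k$ be a field of characteristic $0$ and let $(V,\sigma)$ be a braided vector space over $\mathbf k$: a vector space $V$ with a linear map $\sigma\in\mathrm{End}(V\otimes V)$ (not assumed invertible) satisfying the braid relation $(\sigma\otimes\mathrm{id})(\mathrm{id}\otimes\sigma)(\sigma\otimes\mathrm{id})=(\mathrm{id}\otimes\sigma)(\sigma\otimes\mathrm{id})(\mathrm{id}\otimes\sigma)$ on $V^{\otimes 3}$. Write $f_i$ for a map $f$ of tensor factors applied in the positions $i,i+1$, identity elsewhere. Let $\mathcal B_n$ be the set of planar binary trees with $n$ internal vertices, and $$\mathcal Y(V)=\bigoplus_{n\ge 0}\mathbf k\mathcal B_n\otimes V^{\otimes n}.$$ The element $Y\otimes(v_1\otimes\cdots\otimes v_n)$ is identified with the tree $Y=Y(v_1,\dots,v_n)$ whose internal vertices, ordered from left to right (the $i$-th vertex is the one between the $(i-1)$-th and the $i$-th of the leaves $0,1,\dots,n$), are decorated by $v_1,\dots,v_n$. Let $|\in\mathcal B_0$ be the tree without internal vertices, and let $Y\vee_v Y'$ be the tree obtained by grafting $Y$ (left) and $Y'$ (right) onto a new root decorated by $v$; it defines a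 linear map $\vee:\mathcal Y(V)\otimes V\otimes\mathcal Y(V)\to\mathcal Y(V)$. * The product $*_\sigma$ on $\mathcal Y(V)$ is the bilinear product with unit $|$ defined recursively by $$Y*_\sigma Y'=Y_1\vee_u(Y_2*_\sigma Y')+(Y*_\sigma Y_1')\vee_v Y_2'\qquad\text{for } Y=Y_1\vee_uY_2,\ Y'=Y_1'\vee_vY_2'.$$ * For $m,n\ge0$ let $\beta_{mn}:V^{\otimes m}\otimes V^{\otimes n}\to V^{\otimes n}\otimes V^{\otimes m}$ be the operator $\sigma_{i_1}\cdots\sigma_{i_l}$ on $V^{\otimes(m+n)}$, where $s_{i_1}\cdots s_{i_l}$ is a reduced expression of the permutation $i\mapsto n+i$ $(1\le i\le m)$, $m+j\mapsto j$ $(1\le j\le n)$. The braiding $\sigma_{BT}$ on $\mathcal Y(V)$ is $$\sigma_{BT}\big(Y(v_1,\dots,v_m)\otimes Y'(v_{m+1},\dots,v_{m+n})\big)=(Y'\otimes Y)\,\beta_{mn}(v_1\otimes\cdots\otimes v_{m+n}),$$ and $\sigma_{V,\mathcal Y(V)}:V\otimes\mathcal Y(V)\to\mathcal Y(V)\otimes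 V$ is $v\otimes Y(v_1,\dots,v_m)\mapsto(Y\otimes\mathrm{id}_V)\beta_{1m}(v\otimes v_1\otimes\cdots\otimes v_m)$. * The coproduct $\Delta'_{BT}:\mathcal Y(V)\to\mathcal Y(V)\otimes\mathcal Y(V)$ is the linear map defined recursively by $\Delta'_{BT}(|)=|\otimes|$ and $$\Delta'_{BT}(Y\vee_vY')=(Y\vee_vY')\otimes|+(*_\sigma\otimes\vee)(\sigma_{BT})_2(\sigma_{V,\mathcal Y(V)})_3\big(\Delta'_{BT}(Y)\otimes v\otimes\Delta'_{BT}(Y')\big).$$ * The counit is the linear map $\varepsilon'_{BT}:\mathcal Y(V)\to\mathbf k$ with $\varepsilon'_{BT}(|)=1$ and $\varepsilon'_{BT}(Y)=0$ for every decorated tree $Y$ with at least one internal vertex. **Theorem.** $(\mathcal Y(V),*_\sigma,\Delta'_{BT},\varepsilon'_{BT},\sigma_{BT})$, with unit $|$, is a braided Hopf algebra. That is, with $H=\mathcal Y(V)$, $\mu=*_\sigma$, $1=|$, $\Delta=\Delta'_{BT}$, $\varepsilon=\varepsilon'_{BT}$, $\tau=\sigma_{BT}$: 1. $\tau$ satisfies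 the braid relation on $H^{\otimes3}$; 2. $(H,\mu,1)$ is a unital associative algebra, $(\mu\otimes\mathrm{id})\tau_2\tau_1=\tau(\mathrm{id}\otimes\mu)$, $(\mathrm{id}\otimes\mu)\tau_1\tau_2=\tau(\mu\otimes\mathrm{id})$, and $\tau(a\otimes1)=1\otimes a$, $\tau(1\otimes a)=a\otimes1$ for all $a\in H$; 3. $(H,\Delta,\varepsilon)$ is a coassociative counital coalgebra, $\tau_1\tau_2(\Delta\otimes\mathrm{id})=(\mathrm{id}\otimes\Delta)\tau$, $\tau_2\tau_1(\mathrm{id}\otimes\Delta)=(\Delta\otimes\mathrm{id})\tau$, $(\varepsilon\otimes\mathrm{id})\tau=\mathrm{id}\otimes\varepsilon$ and $(\mathrm{id}\otimes\varepsilon)\tau=\varepsilon\otimes\mathrm{id}$; 4. $\Delta\mu=(\mu\otimes\mu)\tau_2(\Delta\otimes\Delta)$, $\Delta(1)=1\otimes1$, $\varepsilon\mu=\varepsilon\otimes\varepsilon$ and $\varepsilon(1)=1$; 5. there is an antipode: a linear map $S:H\to H$ with $\mu(S\otimes\mathrm{id})\Delta=\varepsilon(\cdot)\,1=\mu(\mathrm{id}\otimes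 S)\Delta$. -/

import Mathlib

open scoped TensorProduct DirectSum

noncomputable section

namespace BraidedTree

/-! ### Braided vector spaces, braided algebras, coalgebras, bialgebras and Hopf algebras -/

section Structures

variable {k : Type*} [CommSemiring k]

/-- The operator `f ⊗ id` on a threefold tensor product `(A ⊗ A) ⊗ A`. -/
def op₁ {A : Type*} [AddCommMonoid A] [Module k A] (f : A ⊗[k] A →ₗ[k] A ⊗[k] A) :
    (A ⊗[k] A) ⊗[k] A →ₗ[k] (A ⊗[k] A) ⊗[k] A :=
  f.rTensor A

/-- The operator `id ⊗ f` on a threefold tensor product `(A ⊗ A) ⊗ A`. -/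
def op₂ {A : Type*} [AddCommMonoid A] [Module k A] (f : A ⊗[k] A →ₗ[k] A ⊗[k] A) :
    (A ⊗[k] A) ⊗[k] A →ₗ[k] (A ⊗[k] A) ⊗[k] A :=
  (TensorProduct.assoc k A A A).symm.toLinearMap ∘ₗ f.lTensor A ∘ₗ
    (TensorProduct.assoc k A A A).toLinearMap

/-- The operator `id ⊗ f ⊗ id`, for `f : B ⊗ C → C' ⊗ B'`, on a fourfold tensor product. -/
def opMid {A B C B' C' D : Type*} [AddCommMonoid A] [Module k A] [AddCommMonoid B] [Module k B]
    [AddCommMonoid C] [Module k C] [AddCommMonoid B'] [Module k B'] [AddCommMonoid C'] [Module k C']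
    [AddCommMonoid D] [Module k D] (f : B ⊗[k] C →ₗ[k] C' ⊗[k] B') :
    (A ⊗[k] B) ⊗[k] (C ⊗[k] D) →ₗ[k] (A ⊗[k] C') ⊗[k] (B' ⊗[k] D) :=
  (TensorProduct.assoc k A C' (B' ⊗[k] D)).symm.toLinearMap ∘ₗ
    ((TensorProduct.assoc k C' B' D).toLinearMap ∘ₗ f.rTensor D ∘ₗ
      (TensorProduct.assoc k B C D).symm.toLinearMap).lTensor A ∘ₗ
    (TensorProduct.assoc k A B (C ⊗[k] D)).toLinearMap

/-- `σ` is a braiding (Yang–Baxter operator) on `A`: it satisfies the braid relation.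
Invertibility is not part of the definition. -/
def IsBraiding {A : Type*} [AddCommMonoid A] [Module k A]
    (σ : A ⊗[k] A →ₗ[k] A ⊗[k] A) : Prop :=
  op₁ σ ∘ₗ op₂ σ ∘ₗ op₁ σ = op₂ σ ∘ₗ op₁ σ ∘ₗ op₂ σ

/-- `(A, μ, σ)` is a unital braided algebra with unit `e`. -/
structure IsBraidedAlgebra {A : Type*} [AddCommMonoid A] [Module k A]
    (μ : A ⊗[k] A →ₗ[k] A) (e : A) (σ : A ⊗[k] A →ₗ[k] A ⊗[k] A) : Prop where
  braiding : IsBraiding σ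
  mul_assoc : ∀ a b c : A, μ (μ (a ⊗ₜ b) ⊗ₜ c) = μ (a ⊗ₜ μ (b ⊗ₜ c))
  one_mul : ∀ a : A, μ (e ⊗ₜ a) = a
  mul_one : ∀ a : A, μ (a ⊗ₜ e) = a
  braid_mul_right : μ.rTensor A ∘ₗ op₂ σ ∘ₗ op₁ σ =
    σ ∘ₗ μ.lTensor A ∘ₗ (TensorProduct.assoc k A A A).toLinearMap
  braid_mul_left : μ.lTensor A ∘ₗ (TensorProduct.assoc k A A A).toLinearMap ∘ₗ op₁ σ ∘ₗ op₂ σ =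
    σ ∘ₗ μ.rTensor A
  braid_one_right : ∀ a : A, σ (a ⊗ₜ e) = e ⊗ₜ a
  braid_one_left : ∀ a : A, σ (e ⊗ₜ a) = a ⊗ₜ e

/-- `(C, Δ, ε, σ)` is a (coassociative, counital) braided coalgebra. -/
structure IsBraidedCoalgebra {C : Type*} [AddCommMonoid C] [Module k C]
    (Δ : C →ₗ[k] C ⊗[k] C) (ε : C →ₗ[k] k) (σ : C ⊗[k] C →ₗ[k] C ⊗[k] C) : Prop where
  braiding : IsBraiding σ
  coassoc : (TensorProduct.assoc k C C C).toLinearMap ∘ₗ Δ.rTensor C ∘ₗ Δ = Δ.lTensor C ∘ₗ Δ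
  counit_left : (TensorProduct.lid k C).toLinearMap ∘ₗ ε.rTensor C ∘ₗ Δ = LinearMap.id
  counit_right : (TensorProduct.rid k C).toLinearMap ∘ₗ ε.lTensor C ∘ₗ Δ = LinearMap.id
  braid_comul_left : op₁ σ ∘ₗ op₂ σ ∘ₗ Δ.rTensor C =
    (TensorProduct.assoc k C C C).symm.toLinearMap ∘ₗ Δ.lTensor C ∘ₗ σ
  braid_comul_right :
    op₂ σ ∘ₗ op₁ σ ∘ₗ (TensorProduct.assoc k C C C).symm.toLinearMap ∘ₗ Δ.lTensor C =
      Δ.rTensor C ∘ₗ σ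
  braid_counit_left : (TensorProduct.lid k C).toLinearMap ∘ₗ ε.rTensor C ∘ₗ σ =
    (TensorProduct.rid k C).toLinearMap ∘ₗ ε.lTensor C
  braid_counit_right : (TensorProduct.rid k C).toLinearMap ∘ₗ ε.lTensor C ∘ₗ σ =
    (TensorProduct.lid k C).toLinearMap ∘ₗ ε.rTensor C

/-- `(H, μ, e, Δ, ε, σ)` is a braided bialgebra: a unital braided algebra and a braided coalgebra
such that `Δ` and `ε` are multiplicative (`H ⊗ H` carrying the product twisted by `σ`) and
unital. -/
structure IsBraidedBialgebra {H : Type*} [AddCommMonoid H] [Module k H]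
    (μ : H ⊗[k] H →ₗ[k] H) (e : H) (Δ : H →ₗ[k] H ⊗[k] H) (ε : H →ₗ[k] k)
    (σ : H ⊗[k] H →ₗ[k] H ⊗[k] H) : Prop where
  algebra : IsBraidedAlgebra μ e σ
  coalgebra : IsBraidedCoalgebra Δ ε σ
  comul_mul : Δ ∘ₗ μ = TensorProduct.map μ μ ∘ₗ opMid σ ∘ₗ TensorProduct.map Δ Δ
  comul_one : Δ e = e ⊗ₜ e
  counit_mul : ∀ a b : H, ε (μ (a ⊗ₜ b)) = ε a * ε b
  counit_one : ε e = 1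

/-- `(H, μ, e, Δ, ε, σ)` is a braided Hopf algebra: a braided bialgebra with an antipode. -/
def IsBraidedHopfAlgebra {H : Type*} [AddCommMonoid H] [Module k H]
    (μ : H ⊗[k] H →ₗ[k] H) (e : H) (Δ : H →ₗ[k] H ⊗[k] H) (ε : H →ₗ[k] k)
    (σ : H ⊗[k] H →ₗ[k] H ⊗[k] H) : Prop :=
  IsBraidedBialgebra μ e Δ ε σ ∧
    ∃ S : H →ₗ[k] H,
      μ ∘ₗ S.rTensor H ∘ₗ Δ = LinearMap.toSpanSingleton k H e ∘ₗ ε ∧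
      μ ∘ₗ S.lTensor H ∘ₗ Δ = LinearMap.toSpanSingleton k H e ∘ₗ ε

end Structures

/-! ### The braiding on tensor powers -/

section Tensor

variable {k : Type*} [CommSemiring k] {V : Type*} [AddCommMonoid V] [Module k V]

variable (k V) in
/-- `V ≃ V^{⊗1}`. -/
def oneEquiv : V ≃ₗ[k] ⨂[k]^1 V :=
  (PiTensorProduct.subsingletonEquiv (R := k) (s := fun _ : Fin 1 => V) 0).symm

variable (k V) in
/-- `V ⊗ V ≃ V^{⊗2}`. -/
def twoEquiv : V ⊗[k] V ≃ₗ[k] ⨂[k]^2 V :=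
  (TensorProduct.congr (oneEquiv k V) (oneEquiv k V)).trans
    (TensorPower.mulEquiv (n := 1) (m := 1))

variable (k V) in
/-- Concatenation `V^{⊗i} ⊗ (V ⊗ V) ⊗ V^{⊗j} ≃ V^{⊗(i+2+j)}`. -/
def insertTwo (i j : ℕ) :
    (⨂[k]^i V ⊗[k] (V ⊗[k] V)) ⊗[k] ⨂[k]^j V ≃ₗ[k] ⨂[k]^(i + 2 + j) V :=
  (TensorProduct.congr
    ((TensorProduct.congr (LinearEquiv.refl k _) (twoEquiv k V)).trans TensorPower.mulEquiv)
    (LinearEquiv.refl k _)).trans TensorPower.mulEquiv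

/-- The operator `id^{⊗i} ⊗ σ ⊗ id^{⊗(n-i-2)}` on `V^{⊗n}`, i.e. `σ` acting on the positions
`i, i+1`, where positions are numbered from `0`. (The identity if `n < i + 2`, never used.) -/
def sigmaAt (σ : V ⊗[k] V →ₗ[k] V ⊗[k] V) (n i : ℕ) : Module.End k (⨂[k]^n V) :=
  if h : i + 2 + (n - (i + 2)) = n then
    ((insertTwo k V i (n - (i + 2))).trans (TensorPower.cast k V h)).conj
      ((σ.lTensor (⨂[k]^i V)).rTensor (⨂[k]^(n - (i + 2)) V))
  else LinearMap.id

/-- A reduced word (in generators numbered from `0`) of the permutation `χ` in `S_{m+n}` that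
moves the block of the first `m` letters past the block of the last `n` letters, preserving the
order inside the blocks:
`(s_{n-1} ⋯ s_0) (s_n ⋯ s_1) ⋯ (s_{m+n-2} ⋯ s_{m-1})`.
Its length `m n` is the number of inversions of `χ`. -/
def blockWord (m n : ℕ) : List ℕ :=
  (List.range m).flatMap fun r => ((List.range n).map fun s => r + s).reverse

/-- `β_{m,n} = T^σ_χ` as an operator on `V^{⊗(m+n)}`: the lift of the block permutation `χ` given
by composing the operators `σ_i` along a reduced word. -/
def betaEnd (σ : V ⊗[k] V →ₗ[k] V ⊗[k] V) (m n : ℕ) : Module.End k (⨂[k]^(m + n) V) :=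
  ((blockWord m n).map (sigmaAt σ (m + n))).prod

/-- `β_{m,n}` as a map `V^{⊗m} ⊗ V^{⊗n} → V^{⊗n} ⊗ V^{⊗m}`. -/
def beta (σ : V ⊗[k] V →ₗ[k] V ⊗[k] V) (m n : ℕ) :
    ⨂[k]^m V ⊗[k] ⨂[k]^n V →ₗ[k] ⨂[k]^n V ⊗[k] ⨂[k]^m V :=
  TensorPower.mulEquiv.symm.toLinearMap ∘ₗ
    (TensorPower.cast k V (Nat.add_comm m n)).toLinearMap ∘ₗ betaEnd σ m n ∘ₗ
    TensorPower.mulEquiv.toLinearMap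

end Tensor

/-! ### Decorated planar binary trees -/

section Trees

/-- Planar binary trees (undecorated). The tree `|` is `BinaryTree.nil`, and grafting of `l` and
`r` onto a new root is `BinaryTree.node () l r`. -/
abbrev PBT : Type := BinaryTree Unit

/-- Planar binary trees with `n` internal vertices. -/
abbrev PBTn (n : ℕ) : Type := {t : PBT // t.numNodes = n}

variable (k : Type*) [CommSemiring k] (V : Type*) [AddCommMonoid V] [Module k V]

/-- `𝒴(V) = ⨁ₙ k𝓑ₙ ⊗ V^{⊗n}`. The element `Y ⊗ (v₁ ⊗ ⋯ ⊗ vₙ)` is the tree `Y` whose internal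
vertices, in the canonical (left to right, i.e. in-order) ordering, are decorated by
`v₁, …, vₙ`. -/
abbrev TreeSpace : Type _ := ⨁ n : ℕ, (PBTn n →₀ k) ⊗[k] ⨂[k]^n V

variable {k V}

/-- `a ↦ Y ⊗ a`, the inclusion of the trees of shape `t`. -/
def ofTree (t : PBT) : ⨂[k]^t.numNodes V →ₗ[k] TreeSpace k V :=
  DirectSum.lof k ℕ (fun n => (PBTn n →₀ k) ⊗[k] ⨂[k]^n V) t.numNodes ∘ₗ
    TensorProduct.mk k _ _ (Finsupp.single (⟨t, rfl⟩ : PBTn t.numNodes) 1)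

/-- The linear map on `𝒴(V)` that is given by `F t` on the trees of shape `t`. -/
def elim {M : Type*} [AddCommMonoid M] [Module k M]
    (F : ∀ t : PBT, ⨂[k]^t.numNodes V →ₗ[k] M) : TreeSpace k V →ₗ[k] M :=
  DirectSum.toModule k ℕ M fun _ =>
    TensorProduct.lift (Finsupp.linearCombination k fun Y : PBTn _ =>
      F Y.1 ∘ₗ (TensorPower.cast k V Y.2.symm).toLinearMap)

/-- The linear map on `𝒴(V) ⊗ A` that is given by `F t` on the trees of shape `t`. -/
def elimL {A M : Type*} [AddCommMonoid A] [Module k A] [AddCommMonoid M] [Module k M]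
    (F : ∀ t : PBT, ⨂[k]^t.numNodes V ⊗[k] A →ₗ[k] M) : TreeSpace k V ⊗[k] A →ₗ[k] M :=
  TensorProduct.lift (elim fun t => TensorProduct.curry (F t))

/-- The linear map on `A ⊗ 𝒴(V)` that is given by `F t` on the trees of shape `t`. -/
def elimR {A M : Type*} [AddCommMonoid A] [Module k A] [AddCommMonoid M] [Module k M]
    (F : ∀ t : PBT, A ⊗[k] ⨂[k]^t.numNodes V →ₗ[k] M) : A ⊗[k] TreeSpace k V →ₗ[k] M :=
  TensorProduct.lift (elim fun t => (TensorProduct.curry (F t)).flip).flip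

/-- Concatenation of the decorations of the left subtree, the root and the right subtree, in this
order. -/
def decor (l r : PBT) :
    ⨂[k]^l.numNodes V ⊗[k] (V ⊗[k] ⨂[k]^r.numNodes V) ≃ₗ[k]
      ⨂[k]^(BinaryTree.node () l r).numNodes V :=
  (TensorProduct.congr (LinearEquiv.refl k _)
      ((TensorProduct.congr (oneEquiv k V) (LinearEquiv.refl k _)).trans
        TensorPower.mulEquiv)).trans
    (TensorPower.mulEquiv.trans (TensorPower.cast k V (by simp only [BinaryTree.numNodes]; omega)))

/-- The grafting operation `y ⊗ v ⊗ z ↦ y ∨_v z`. -/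
def graft : TreeSpace k V ⊗[k] (V ⊗[k] TreeSpace k V) →ₗ[k] TreeSpace k V :=
  elimL fun l =>
    elimR (fun r => ofTree (.node () l r) ∘ₗ (decor l r).toLinearMap ∘ₗ
      (TensorProduct.assoc k _ _ _).toLinearMap) ∘ₗ
    (TensorProduct.assoc k _ _ _).symm.toLinearMap

/-- `V^{⊗0} ≃ k`, the decorations of the tree `|`. -/
def nilScalar : ⨂[k]^(BinaryTree.nil : PBT).numNodes V ≃ₗ[k] k :=
  (TensorPower.algebraMap₀ (R := k) (M := V)).symm

/-- The tree `|`. -/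
def leaf : TreeSpace k V := ofTree .nil (nilScalar.symm 1)

/-- The product `*` on trees of shapes `s` and `t`, by recursion:
`| * Y = Y = Y * |` and, for `Y = Y₁ ∨_u Y₂` and `Y' = Y'₁ ∨_v Y'₂`,
`Y * Y' = Y ≺ Y' + Y ≻ Y' = Y₁ ∨_u (Y₂ * Y') + (Y * Y'₁) ∨_v Y'₂`. -/
def mulAux : ∀ s t : PBT,
    ⨂[k]^s.numNodes V ⊗[k] ⨂[k]^t.numNodes V →ₗ[k] TreeSpace k V
  | .nil, t => ofTree t ∘ₗ (TensorProduct.lid k _).toLinearMap ∘ₗ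
      nilScalar.toLinearMap.rTensor _
  | .node u l r, .nil => ofTree (.node u l r) ∘ₗ (TensorProduct.rid k _).toLinearMap ∘ₗ
      nilScalar.toLinearMap.lTensor _
  | .node u l r, .node u' l' r' =>
      (graft ∘ₗ
        TensorProduct.map (ofTree l) (TensorProduct.map LinearMap.id (mulAux r (.node u' l' r'))) ∘ₗ
        (TensorProduct.assoc k V _ _).toLinearMap.lTensor _ ∘ₗ
        (TensorProduct.assoc k _ (V ⊗[k] _) _).toLinearMap ∘ₗ
        (decor l r).symm.toLinearMap.rTensor _) +
      (graft ∘ₗ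
        TensorProduct.map (mulAux (.node u l r) l') (TensorProduct.map LinearMap.id (ofTree r')) ∘ₗ
        (TensorProduct.assoc k _ _ (V ⊗[k] _)).symm.toLinearMap ∘ₗ
        (decor l' r').symm.toLinearMap.lTensor _)
termination_by s t => s.numNodes + t.numNodes
decreasing_by all_goals simp only [BinaryTree.numNodes]; omega

/-- The product `*` of `𝒴(V)` (written `*_σ` when `V` is braided; it does not involve `σ`). -/
def mul : TreeSpace k V ⊗[k] TreeSpace k V →ₗ[k] TreeSpace k V :=
  elimL fun s => elimR fun t => mulAux s t

/-- The braiding `σ_BT` of `𝒴(V)`: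
`Y(v₁,…,v_m) ⊗ Y'(v_{m+1},…,v_{m+n}) ↦ (Y' ⊗ Y) β_{m,n}(v₁ ⊗ ⋯ ⊗ v_{m+n})`. -/
def sigmaBT (σ : V ⊗[k] V →ₗ[k] V ⊗[k] V) :
    TreeSpace k V ⊗[k] TreeSpace k V →ₗ[k] TreeSpace k V ⊗[k] TreeSpace k V :=
  elimL fun s => elimR fun t =>
    TensorProduct.map (ofTree t) (ofTree s) ∘ₗ beta σ s.numNodes t.numNodes

/-- The map `σ_{V,𝒴(V)} : V ⊗ 𝒴(V) → 𝒴(V) ⊗ V`,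
`v ⊗ Y(v₁,…,v_m) ↦ (Y ⊗ id) β_{1,m}(v ⊗ v₁ ⊗ ⋯ ⊗ v_m)`. -/
def sigmaVY (σ : V ⊗[k] V →ₗ[k] V ⊗[k] V) :
    V ⊗[k] TreeSpace k V →ₗ[k] TreeSpace k V ⊗[k] V :=
  elimR fun t =>
    TensorProduct.map (ofTree t) (oneEquiv k V).symm.toLinearMap ∘ₗ beta σ 1 t.numNodes ∘ₗ
      (oneEquiv k V).toLinearMap.rTensor _

/-- `(*_σ, ∨) = (*_σ ⊗ ∨) (σ_BT)₂ (σ_{V,𝒴(V)})₃` on `𝒴(V) ⊗ 𝒴(V) ⊗ V ⊗ 𝒴(V) ⊗ 𝒴(V)`. -/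
def mulGraft (σ : V ⊗[k] V →ₗ[k] V ⊗[k] V) :
    (TreeSpace k V ⊗[k] TreeSpace k V) ⊗[k] (V ⊗[k] (TreeSpace k V ⊗[k] TreeSpace k V)) →ₗ[k]
      TreeSpace k V ⊗[k] TreeSpace k V :=
  TensorProduct.map mul graft ∘ₗ
    opMid (sigmaBT σ) ∘ₗ
    ((TensorProduct.assoc k (TreeSpace k V) V (TreeSpace k V)).toLinearMap ∘ₗ
      (sigmaVY σ).rTensor (TreeSpace k V) ∘ₗ
      (TensorProduct.assoc k V (TreeSpace k V) (TreeSpace k V)).symm.toLinearMap).lTensor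
        (TreeSpace k V ⊗[k] TreeSpace k V)

/-- The coproduct `Δ'_BT` on trees of shape `t`, by recursion: `Δ'(|) = | ⊗ |` and
`Δ'(Y ∨_v Y') = (Y ∨_v Y') ⊗ | + (*_σ, ∨)(Δ'(Y) ⊗ v ⊗ Δ'(Y'))`. -/
def comulAux (σ : V ⊗[k] V →ₗ[k] V ⊗[k] V) : ∀ t : PBT,
    ⨂[k]^t.numNodes V →ₗ[k] TreeSpace k V ⊗[k] TreeSpace k V
  | .nil => (TensorProduct.mk k _ _).flip leaf ∘ₗ ofTree .nil
  | .node u l r =>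
      (TensorProduct.mk k _ _).flip leaf ∘ₗ ofTree (.node u l r) +
      mulGraft σ ∘ₗ
        TensorProduct.map (comulAux σ l) (TensorProduct.map LinearMap.id (comulAux σ r)) ∘ₗ
        (decor l r).symm.toLinearMap

/-- The coproduct `Δ'_BT` of `𝒴(V)`. -/
def comul (σ : V ⊗[k] V →ₗ[k] V ⊗[k] V) :
    TreeSpace k V →ₗ[k] TreeSpace k V ⊗[k] TreeSpace k V :=
  elim (comulAux σ)

/-- The counit `ε'_BT` on trees of shape `t`: zero unless `t = |`. -/
def counitAux : ∀ t : PBT, ⨂[k]^t.numNodes V →ₗ[k] k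
  | .nil => nilScalar.toLinearMap
  | .node _ _ _ => 0

/-- The counit `ε'_BT` of `𝒴(V)`, `ε'_BT(Y) = δ_{Y,|}`. -/
def counit : TreeSpace k V →ₗ[k] k := elim counitAux

/-! The recursions hold for all elements of `𝒴(V)`. -/

@[simp]
theorem elim_ofTree {M : Type*} [AddCommMonoid M] [Module k M]
    (F : ∀ t : PBT, ⨂[k]^t.numNodes V →ₗ[k] M) (t : PBT) (a : ⨂[k]^t.numNodes V) :
    elim F (ofTree t a) = F t a := by
  simp [elim, ofTree]

@[simp]
theorem elimL_ofTree {A M : Type*} [AddCommMonoid A] [Module k A] [AddCommMonoid M] [Module k M]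
    (F : ∀ t : PBT, ⨂[k]^t.numNodes V ⊗[k] A →ₗ[k] M) (t : PBT) (a : ⨂[k]^t.numNodes V) (x : A) :
    elimL F (ofTree t a ⊗ₜ x) = F t (a ⊗ₜ x) := by
  simp [elimL]

@[simp]
theorem elimR_ofTree {A M : Type*} [AddCommMonoid A] [Module k A] [AddCommMonoid M] [Module k M]
    (F : ∀ t : PBT, A ⊗[k] ⨂[k]^t.numNodes V →ₗ[k] M) (t : PBT) (a : ⨂[k]^t.numNodes V) (x : A) :
    elimR F (x ⊗ₜ ofTree t a) = F t (x ⊗ₜ a) := by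
  simp [elimR]

/-- `𝒴(V)` is spanned by the decorated trees. -/
theorem treeSpace_induction {P : TreeSpace k V → Prop}
    (h_of : ∀ t a, P (ofTree t a)) (h_add : ∀ x y, P x → P y → P (x + y)) (x : TreeSpace k V) :
    P x := by
  have h0 : P 0 := by
    have := h_of .nil 0
    rwa [map_zero] at this
  induction x using DirectSum.induction_on with
  | zero => exact h0
  | add x y hx hy => exact h_add x y hx hy
  | of n x =>
    induction x using TensorProduct.induction_on with
    | zero => simpa using h0
    | add x y hx hy => rw [map_add]; exact h_add _ _ hx hy
    | tmul f a =>
      induction f using Finsupp.induction_linear with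
      | zero => simpa using h0
      | add f g hf hg => rw [TensorProduct.add_tmul, map_add]; exact h_add _ _ hf hg
      | single Y c =>
        obtain ⟨t, rfl⟩ := Y
        have := h_of t (c • a)
        rw [ofTree, LinearMap.comp_apply, TensorProduct.mk_apply, ← TensorProduct.smul_tmul,
          Finsupp.smul_single, smul_eq_mul, mul_one] at this
        exact this

theorem graft_ofTree (l r : PBT) (a : ⨂[k]^l.numNodes V) (v : V) (b : ⨂[k]^r.numNodes V) :
    graft (ofTree l a ⊗ₜ (v ⊗ₜ ofTree r b)) =
      ofTree (.node () l r) (decor l r (a ⊗ₜ (v ⊗ₜ b))) := by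
  simp only [graft, elimL_ofTree, LinearMap.comp_apply, LinearEquiv.coe_coe,
    TensorProduct.assoc_symm_tmul, elimR_ofTree]
  rfl

theorem mul_ofTree (s t : PBT) (a : ⨂[k]^s.numNodes V) (b : ⨂[k]^t.numNodes V) :
    mul (ofTree s a ⊗ₜ ofTree t b) = mulAux s t (a ⊗ₜ b) := by
  simp only [mul, elimL_ofTree, elimR_ofTree]

theorem leaf_mul (y : TreeSpace k V) : mul (leaf ⊗ₜ y) = y := by
  induction y using treeSpace_induction with
  | h_add x y hx hy => rw [TensorProduct.tmul_add, map_add, hx, hy]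
  | h_of t a =>
    rw [leaf, mul_ofTree, mulAux]
    simp only [LinearMap.comp_apply, LinearMap.rTensor_tmul, LinearEquiv.coe_coe,
      LinearEquiv.apply_symm_apply, TensorProduct.lid_tmul, one_smul]

theorem mul_leaf (y : TreeSpace k V) : mul (y ⊗ₜ leaf) = y := by
  induction y using treeSpace_induction with
  | h_add x y hx hy => rw [TensorProduct.add_tmul, map_add, hx, hy]
  | h_of t a =>
    cases t with
    | nil =>
      rw [leaf, mul_ofTree, mulAux]
      obtain ⟨c, rfl⟩ := (nilScalar (k := k) (V := V)).symm.surjective a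
      simp only [LinearMap.comp_apply, LinearMap.rTensor_tmul, LinearEquiv.coe_coe,
        LinearEquiv.apply_symm_apply, TensorProduct.lid_tmul, ← map_smul, smul_eq_mul, mul_one]
    | node u l r =>
      rw [leaf, mul_ofTree, mulAux]
      simp only [LinearMap.comp_apply, LinearMap.lTensor_tmul, LinearEquiv.coe_coe,
        LinearEquiv.apply_symm_apply, TensorProduct.rid_tmul, one_smul]

theorem mul_graft_graft (y₁ y₂ y₁' y₂' : TreeSpace k V) (u v : V) :
    mul (graft (y₁ ⊗ₜ (u ⊗ₜ y₂)) ⊗ₜ graft (y₁' ⊗ₜ (v ⊗ₜ y₂'))) =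
      graft (y₁ ⊗ₜ (u ⊗ₜ mul (y₂ ⊗ₜ graft (y₁' ⊗ₜ (v ⊗ₜ y₂'))))) +
      graft (mul (graft (y₁ ⊗ₜ (u ⊗ₜ y₂)) ⊗ₜ y₁') ⊗ₜ (v ⊗ₜ y₂')) := by
  induction y₁ using treeSpace_induction with
  | h_add x y hx hy =>
    simp only [TensorProduct.add_tmul, map_add, hx, hy]; abel
  | h_of s₁ a₁ =>
  induction y₂ using treeSpace_induction with
  | h_add x y hx hy =>
    simp only [TensorProduct.add_tmul, TensorProduct.tmul_add, map_add, hx, hy]; abel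
  | h_of s₂ a₂ =>
  induction y₁' using treeSpace_induction with
  | h_add x y hx hy =>
    simp only [TensorProduct.add_tmul, TensorProduct.tmul_add, map_add, hx, hy]; abel
  | h_of t₁ b₁ =>
  induction y₂' using treeSpace_induction with
  | h_add x y hx hy =>
    simp only [TensorProduct.tmul_add, map_add, hx, hy]; abel
  | h_of t₂ b₂ =>
  simp only [graft_ofTree, mul_ofTree]
  rw [mulAux]
  simp only [LinearMap.add_apply, LinearMap.comp_apply, LinearMap.rTensor_tmul,
    LinearMap.lTensor_tmul, LinearEquiv.coe_coe, LinearEquiv.symm_apply_apply,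
    TensorProduct.assoc_tmul, TensorProduct.assoc_symm_tmul, TensorProduct.map_tmul,
    LinearMap.id_apply]

theorem comul_leaf (σ : V ⊗[k] V →ₗ[k] V ⊗[k] V) :
    comul σ (leaf : TreeSpace k V) = leaf ⊗ₜ leaf := by
  simp only [comul, leaf, elim_ofTree, comulAux]
  rfl

theorem comul_graft (σ : V ⊗[k] V →ₗ[k] V ⊗[k] V) (y y' : TreeSpace k V) (v : V) :
    comul σ (graft (y ⊗ₜ (v ⊗ₜ y'))) =
      graft (y ⊗ₜ (v ⊗ₜ y')) ⊗ₜ leaf +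
        mulGraft σ (comul σ y ⊗ₜ (v ⊗ₜ comul σ y')) := by
  induction y using treeSpace_induction with
  | h_add x y hx hy =>
    simp only [TensorProduct.add_tmul, map_add, hx, hy]; abel
  | h_of s a =>
  induction y' using treeSpace_induction with
  | h_add x y hx hy =>
    simp only [TensorProduct.add_tmul, TensorProduct.tmul_add, map_add, hx, hy]; abel
  | h_of t b =>
  simp only [graft_ofTree, comul, elim_ofTree]
  rw [comulAux]
  simp only [LinearMap.add_apply, LinearMap.comp_apply, LinearEquiv.coe_coe,
    LinearEquiv.symm_apply_apply, TensorProduct.map_tmul, LinearMap.id_apply,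
    LinearMap.flip_apply, TensorProduct.mk_apply]

end Trees

end BraidedTree

end

/-! Every structure map is a sum of terms of one kind: the trees are reshaped combinatorially, while
a positive braid acts on the decorations through `σ`. The braid relation is what makes the operators
`σ_i` an action `act` of the positive braid monoid on the tensor algebra; a monoid replaces the
braid group because `σ` need not be invertible. On trees of a fixed shape a map is therefore
recorded by a finite multiset of pairs (target index, braid), see `RepAt`. Composition multiplies
braids (`RepAt.comp`), tensoring puts them side by side (`RepAt.map`), so the main bialgebra
identities reduce to identities of multisets in which `V` no longer appears (`eq_of_repAt_of_eq`).

The product keeps the left-to-right order of the decorations, hence carries only trivial braids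
(`mulTrees`); the braiding is a block crossing `blk`; the coproduct is `cuts`. Three facts about
braids suffice: block crossings split along either block (`blk_add_left`, `blk_add_right`), a braid
inside a block slides through the crossing (`blk_mul`, `blk_mul_shift`), and braids on disjoint
strands commute (`mul_shift_comm`). They give at once the Yang–Baxter equation and the compatibility
of the braiding with product and coproduct.

Multiplicativity of the coproduct (`mulTrees_bind_cuts`) is an induction along the recursion of the
product: apart from the terms with second leg `|`, the root of the second leg comes from one of the
two factors, and associativity of the product matches each case with an inductive hypothesis. For
coassociativity, both iterated coproducts satisfy the same recursion; on the left this uses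
multiplicativity.

The coproduct preserves the number of vertices and the trees without vertices span only the line of
`|`. Hence the unit minus the identity is locally nilpotent for convolution, and its geometric
series is an antipode. -/

noncomputable section

namespace BraidedTree

/-! ### The positive braid monoid on infinitely many strands -/

section PosBraid

/-- The defining relations of the positive braid monoid. -/
inductive BraidRel : FreeMonoid ℕ → FreeMonoid ℕ → Prop
  | braid (i : ℕ) : BraidRel (.of i * .of (i + 1) * .of i) (.of (i + 1) * .of i * .of (i + 1))
  | comm (i j : ℕ) (h : i + 2 ≤ j) : BraidRel (.of i * .of j) (.of j * .of i)

/-- The positive braid monoid on infinitely many strands. -/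
abbrev PosBraid : Type := PresentedMonoid BraidRel

namespace PosBraid

/-- The elementary braid crossing the strands `i` and `i + 1`. -/
def gen (i : ℕ) : PosBraid := PresentedMonoid.of BraidRel i

theorem gen_braid (i : ℕ) : gen i * gen (i + 1) * gen i = gen (i + 1) * gen i * gen (i + 1) :=
  PresentedMonoid.mk_eq_mk_of_rel (.braid i)

theorem gen_comm {i j : ℕ} (h : i + 2 ≤ j) : gen i * gen j = gen j * gen i :=
  PresentedMonoid.mk_eq_mk_of_rel (.comm i j h)

/-- The homomorphism out of the positive braid monoid determined by the images of the generators. -/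
def lift {M : Type*} [Monoid M] (f : ℕ → M)
    (h₁ : ∀ i, f i * f (i + 1) * f i = f (i + 1) * f i * f (i + 1))
    (h₂ : ∀ i j, i + 2 ≤ j → f i * f j = f j * f i) : PosBraid →* M :=
  PresentedMonoid.lift f (by
    rintro _ _ (i | ⟨i, j, h⟩)
    · simpa using h₁ i
    · simpa using h₂ i j h)

@[simp]
theorem lift_gen {M : Type*} [Monoid M] (f : ℕ → M) (h₁ h₂) (i : ℕ) :
    lift f h₁ h₂ (gen i) = f i := rfl

@[elab_as_elim]
theorem induction {P : PosBraid → Prop} (one : P 1) (gen_mul : ∀ i w, P w → P (gen i * w))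
    (w : PosBraid) : P w := by
  induction w using PresentedMonoid.inductionOn with | h a
  induction a using FreeMonoid.recOn with
  | one => exact one
  | of_mul i w hw => exact gen_mul i _ hw

theorem hom_ext {M : Type*} [Monoid M] {f g : PosBraid →* M} (h : ∀ i, f (gen i) = g (gen i)) :
    f = g := by
  refine MonoidHom.ext fun w => ?_
  induction w using induction with
  | one => simp
  | gen_mul i w hw => simp [h, hw]

/-- Adding `n` trivial strands on the left. -/
def shift (n : ℕ) : PosBraid →* PosBraid :=
  lift (fun i => gen (n + i)) (fun i => gen_braid (n + i)) fun _ _ h => gen_comm (by omega)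

@[simp]
theorem shift_gen (n i : ℕ) : shift n (gen i) = gen (n + i) := rfl

@[simp]
theorem shift_zero (w : PosBraid) : shift 0 w = w :=
  DFunLike.congr_fun (hom_ext (g := MonoidHom.id _) fun i => by simp) w

@[simp]
theorem shift_shift (m n : ℕ) (w : PosBraid) : shift m (shift n w) = shift (m + n) w :=
  DFunLike.congr_fun (hom_ext (f := (shift m).comp (shift n)) (g := shift (m + n))
    fun i => by simp [add_assoc]) w

/-- The braids on the first `m` strands. -/
def strands (m : ℕ) : Submonoid PosBraid := Submonoid.closure {w | ∃ i, i + 2 ≤ m ∧ w = gen i}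

theorem gen_mem_strands {i m : ℕ} (h : i + 2 ≤ m) : gen i ∈ strands m :=
  Submonoid.subset_closure ⟨i, h, rfl⟩

theorem strands_mono {m n : ℕ} (h : m ≤ n) : strands m ≤ strands n := by
  refine Submonoid.closure_mono ?_
  rintro _ ⟨i, hi, rfl⟩
  exact ⟨i, by omega, rfl⟩

theorem shift_mem_strands {m n l : ℕ} {w : PosBraid} (hw : w ∈ strands n) (h : m + n ≤ l) :
    shift m w ∈ strands l := by
  induction hw using Submonoid.closure_induction with
  | mem w hw =>
    obtain ⟨i, hi, rfl⟩ := hw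
    exact gen_mem_strands (by omega)
  | one => simp
  | mul x y _ _ hx hy => rw [map_mul]; exact mul_mem hx hy

theorem gen_mul_shift {i n : ℕ} (h : i + 2 ≤ n) (w : PosBraid) :
    gen i * shift n w = shift n w * gen i := by
  induction w using induction with
  | one => simp
  | gen_mul j w hw =>
    rw [map_mul, shift_gen, ← mul_assoc, gen_comm (by omega), mul_assoc, hw, mul_assoc]

/-- Braids on disjoint sets of strands commute. -/
theorem mul_shift_comm {m n : ℕ} {v : PosBraid} (hv : v ∈ strands m) (h : m ≤ n) (w : PosBraid) :
    v * shift n w = shift n w * v := by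
  induction hv using Submonoid.closure_induction with
  | mem v hv =>
    obtain ⟨i, hi, rfl⟩ := hv
    exact gen_mul_shift (by omega) w
  | one => simp
  | mul x y _ _ hx hy => rw [mul_assoc, hy, ← mul_assoc, hx, mul_assoc]

/-! ### Block crossings and their naturality. -/

/-- The braid moving the first strand past the next `n` strands. -/
def cyc : ℕ → PosBraid
  | 0 => 1
  | n + 1 => gen n * cyc n

/-- The braid moving the first `m` strands past the next `n` strands. -/
def blk : ℕ → ℕ → PosBraid
  | 0, _ => 1
  | m + 1, n => cyc n * shift 1 (blk m n)

theorem cyc_add (n n' : ℕ) : cyc (n + n') = shift n (cyc n') * cyc n := by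
  induction n' with
  | zero => simp [cyc]
  | succ n' ih => rw [← add_assoc, cyc, ih, cyc, map_mul, shift_gen, mul_assoc]

theorem cyc_mem_strands {n m : ℕ} (h : n + 1 ≤ m) : cyc n ∈ strands m := by
  induction n with
  | zero => simp [cyc]
  | succ n ih => exact mul_mem (gen_mem_strands h) (ih (by omega))

theorem blk_mem_strands {m n l : ℕ} (h : m + n ≤ l) : blk m n ∈ strands l := by
  induction m generalizing l with
  | zero => simp [blk]
  | succ m ih =>
    exact mul_mem (cyc_mem_strands (by omega)) (shift_mem_strands (ih le_rfl) (by omega))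

@[simp]
theorem blk_zero_left (n : ℕ) : blk 0 n = 1 := rfl

@[simp]
theorem blk_zero_right (m : ℕ) : blk m 0 = 1 := by
  induction m with
  | zero => rfl
  | succ m ih => simp [blk, cyc, ih]

theorem blk_add_left (m m' n : ℕ) : blk (m + m') n = blk m n * shift m (blk m' n) := by
  induction m with
  | zero => simp
  | succ m ih => rw [Nat.succ_add, blk, ih, blk, map_mul, shift_shift, mul_assoc, add_comm 1 m]

/-- Induction on the strands of the first block: the passage of the leading strand past the first
`n` strands is disjoint from the passage of the remaining ones past the last `n'`, so the two can be
exchanged. -/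
theorem blk_add_right (m n n' : ℕ) : blk m (n + n') = shift n (blk m n') * blk m n := by
  induction m with
  | zero => simp
  | succ m ih =>
    rw [blk, ih, cyc_add, map_mul, shift_shift, mul_assoc, ← mul_assoc (cyc n), add_comm 1 n,
      mul_shift_comm (cyc_mem_strands le_rfl) le_rfl, blk, blk, map_mul, shift_shift]
    simp only [mul_assoc]

/-- A third Reidemeister move for each of the `n` strands. This is the one case of `blk_mul` where
the braid relation enters. -/
theorem blk_two_mul_gen (n : ℕ) : blk 2 n * gen 0 = gen n * blk 2 n := by
  have key : cyc n * shift 1 (cyc n) * gen 0 = gen n * (cyc n * shift 1 (cyc n)) := by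
    induction n with
    | zero => simp [cyc]
    | succ n ih =>
      have h : cyc n * gen (n + 1) = gen (n + 1) * cyc n :=
        mul_shift_comm (cyc_mem_strands le_rfl) le_rfl (gen 0)
      calc cyc (n + 1) * shift 1 (cyc (n + 1)) * gen 0
          = gen n * (cyc n * gen (n + 1)) * shift 1 (cyc n) * gen 0 := by
            simp only [cyc, map_mul, shift_gen, mul_assoc, add_comm 1 n]
        _ = gen n * gen (n + 1) * (cyc n * shift 1 (cyc n) * gen 0) := by
            rw [h]; simp only [mul_assoc]
        _ = (gen n * gen (n + 1) * gen n) * (cyc n * shift 1 (cyc n)) := by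
            rw [ih]; simp only [mul_assoc]
        _ = gen (n + 1) * gen n * (gen (n + 1) * cyc n) * shift 1 (cyc n) := by
            rw [gen_braid]; simp only [mul_assoc]
        _ = _ := by
            rw [← h]; simp only [cyc, map_mul, shift_gen, mul_assoc, add_comm 1 n]
  simpa [blk] using key

/-- Naturality of the block braids in the first block. -/
theorem blk_mul {m n : ℕ} {w : PosBraid} (hw : w ∈ strands m) :
    blk m n * w = shift n w * blk m n := by
  induction hw using Submonoid.closure_induction with
  | one => simp
  | mul x y _ _ hx hy => rw [← mul_assoc, hx, mul_assoc, hy, map_mul, mul_assoc]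
  | mem w hw =>
    obtain ⟨i, hi, rfl⟩ := hw
    obtain ⟨j, rfl⟩ := Nat.exists_eq_add_of_le hi
    -- The first block is cut into `i`, `2` and `j` strands. Only the middle part meets the
    -- crossing; the outer parts commute with it by disjointness.
    have h₁ : shift (i + 2) (blk j n) * gen i = gen i * shift (i + 2) (blk j n) :=
      (mul_shift_comm (gen_mem_strands le_rfl) le_rfl _).symm
    have h₂ : shift i (blk 2 n) * gen i = gen (n + i) * shift i (blk 2 n) := by
      have := congrArg (shift i) (blk_two_mul_gen n)
      simpa only [map_mul, shift_gen, add_zero, add_comm i n] using this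
    have h₃ : blk i n * gen (n + i) = gen (n + i) * blk i n :=
      mul_shift_comm (blk_mem_strands (add_comm i n).le) le_rfl (gen 0)
    rw [blk_add_left, blk_add_left, shift_gen, mul_assoc, h₁, ← mul_assoc, mul_assoc (blk i n), h₂,
      ← mul_assoc, h₃]
    simp only [mul_assoc]

/-- A single strand passes a crossing of two others. Everything but the generators `j` and `j + 1`
of `cyc n` commutes out of the way, and one braid relation remains. -/
theorem cyc_mul_gen {j n : ℕ} (h : j + 2 ≤ n) : cyc n * gen (j + 1) = gen j * cyc n := by
  obtain ⟨n, rfl⟩ := Nat.exists_eq_add_of_le h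
  have h₁ : cyc j * gen (j + 1) = gen (j + 1) * cyc j :=
    mul_shift_comm (cyc_mem_strands le_rfl) le_rfl (gen 0)
  have h₂ : gen j * shift (j + 2) (cyc n) = shift (j + 2) (cyc n) * gen j :=
    gen_mul_shift le_rfl _
  have h₃ : cyc (j + 2) = gen (j + 1) * (gen j * cyc j) := rfl
  rw [cyc_add, ← mul_assoc (gen j), h₂, h₃, mul_assoc, mul_assoc _ _ (_ * _)]
  congr 1
  calc gen (j + 1) * (gen j * cyc j) * gen (j + 1)
      = gen (j + 1) * gen j * (cyc j * gen (j + 1)) := by simp only [mul_assoc]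
    _ = gen (j + 1) * gen j * gen (j + 1) * cyc j := by rw [h₁]; simp only [mul_assoc]
    _ = _ := by rw [← gen_braid]; simp only [mul_assoc]

/-- Naturality of the block braids in the second block. -/
theorem blk_mul_shift {m n : ℕ} {w : PosBraid} (hw : w ∈ strands n) :
    blk m n * shift m w = w * blk m n := by
  induction hw using Submonoid.closure_induction with
  | one => simp
  | mul x y _ _ hx hy => rw [map_mul, ← mul_assoc, hx, mul_assoc, hy, mul_assoc]
  | mem w hw =>
    obtain ⟨j, hj, rfl⟩ := hw
    induction m with
    | zero => simp
    | succ m ih =>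
      have h := congrArg (shift 1) ih
      rw [map_mul, shift_shift, map_mul, shift_gen 1] at h
      rw [blk, mul_assoc, add_comm m 1, h, ← mul_assoc, add_comm 1 j, cyc_mul_gen hj, mul_assoc]

end PosBraid

end PosBraid

/-! ### Structure constants of the product and the coproduct of trees -/

section StructureConstants

open Multiset PosBraid

theorem bind_singleton_self {α : Type*} (s : Multiset α) : s.bind (fun a => {a}) = s :=
  (bind_singleton s id).trans (map_id s)

theorem add_add_add_of_eq {M : Type*} [AddCommMonoid M] {a a₁ a₂ b b' c d : M} (h₁ : a = a₁ + a₂)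
    (h₂ : b + d = b') : a + b + (c + d) = a₁ + c + (a₂ + b') := by
  rw [h₁, ← h₂]; abel

/-- The trees occurring in the product of two trees, with multiplicities. -/
def mulTrees : PBT → PBT → Multiset PBT
  | .nil, t => {t}
  | .node _ l r, .nil => {.node () l r}
  | .node _ l r, .node _ l' r' =>
      (mulTrees r (.node () l' r')).map (.node () l) +
        (mulTrees (.node () l r) l').map (.node () · r')
termination_by s t => s.numNodes + t.numNodes
decreasing_by all_goals simp only [BinaryTree.numNodes]; omega

@[simp]
theorem numNodes_node (u : Unit) (l r : PBT) :
    (BinaryTree.node u l r).numNodes = l.numNodes + r.numNodes + 1 := rfl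

@[simp]
theorem nil_mulTrees (t : PBT) : mulTrees .nil t = {t} := by rw [mulTrees]

@[simp]
theorem mulTrees_nil (t : PBT) : mulTrees t .nil = {t} := by
  cases t <;> rw [mulTrees]

theorem node_mulTrees_node (l r l' r' : PBT) :
    mulTrees (.node () l r) (.node () l' r') =
      (mulTrees r (.node () l' r')).map (.node () l) +
        (mulTrees (.node () l r) l').map (.node () · r') := by
  rw [mulTrees]

theorem numNodes_of_mem_mulTrees {s t u : PBT} (h : u ∈ mulTrees s t) :
    u.numNodes = s.numNodes + t.numNodes := by
  induction s, t using mulTrees.induct generalizing u with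
  | case1 t => simp_all
  | case2 => simp_all
  | case3 _ l r _ l' r' ih₁ ih₂ =>
    rw [node_mulTrees_node, mem_add, mem_map, mem_map] at h
    obtain ⟨v, hv, rfl⟩ | ⟨v, hv, rfl⟩ := h
    · have := ih₁ hv; simp only [numNodes_node] at *; omega
    · have := ih₂ hv; simp only [numNodes_node] at *; omega

/-- For three nonempty trees, the terms are sorted by the factor whose root becomes the root of the
product. A root from the first or the third factor is covered by induction on the total number of
vertices. -/
theorem mulTrees_assoc (s t u : PBT) :
    (mulTrees s t).bind (mulTrees · u) = (mulTrees t u).bind (mulTrees s ·) := by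
  induction h : s.numNodes + t.numNodes + u.numNodes using Nat.strong_induction_on
    generalizing s t u with
  | _ n ih =>
  subst h
  match s, t, u with
  | .nil, t, u => simp [bind_singleton_self]
  | .node () l r, .nil, u => simp
  | .node () l r, .node () l' r', .nil => simp [bind_singleton_self]
  | .node () l r, .node () l' r', .node () l'' r'' =>
    have h₁ := congrArg (map (BinaryTree.node () l))
      (ih _ (by simp only [numNodes_node]; omega) r (.node () l' r') (.node () l'' r'') rfl)
    have h₂ := congrArg (map (BinaryTree.node () · r''))
      (ih _ (by simp only [numNodes_node]; omega) (.node () l r) (.node () l' r') l'' rfl)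
    simp only [node_mulTrees_node, add_bind, Multiset.bind_map, bind_add, Multiset.map_bind, Multiset.map_add] at h₁ h₂ ⊢
    -- Root from the middle factor: its left and right branches are multiplied independently, so the
    -- two sums are merely interchanged.
    have h₃ : ((mulTrees (.node () l r) l').bind fun a =>
          (mulTrees r' (.node () l'' r'')).map (BinaryTree.node () a)) =
        (mulTrees r' (.node () l'' r'')).bind fun a =>
          (mulTrees (.node () l r) l').map (BinaryTree.node () · a) := bind_map_comm ..
    rw [h₃]
    exact add_add_add_of_eq h₁ h₂

/-! ### Terms of the coproduct, and its multiplicativity. -/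

/-- A pair of trees together with a braid. -/
abbrev Cut : Type := (PBT × PBT) × PosBraid

/-- The terms of the coproduct of a tree with `m` vertices left of the root, apart from the
first one. -/
def nodeCuts (m : ℕ) (L R : Multiset Cut) : Multiset Cut :=
  L.bind fun a => R.bind fun b => (mulTrees a.1.1 b.1.1).map fun u =>
    ((u, .node () a.1.2 b.1.2),
      shift a.1.1.numNodes (blk (a.1.2.numNodes + 1) b.1.1.numNodes) * a.2 * shift (m + 1) b.2)

/-- The terms of the coproduct of a tree. -/
def cuts : PBT → Multiset Cut
  | .nil => {((.nil, .nil), 1)}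
  | .node _ l r => {((.node () l r, .nil), 1)} + nodeCuts l.numNodes (cuts l) (cuts r)

@[simp]
theorem cuts_nil : cuts .nil = {((.nil, .nil), 1)} := rfl

theorem cuts_node (l r : PBT) : cuts (.node () l r) =
    {((.node () l r, .nil), 1)} + nodeCuts l.numNodes (cuts l) (cuts r) := rfl

/-- The coproduct is graded and its braids stay on the strands of the tree. The second part licenses
every exchange of braids coming from different branches or factors. -/
theorem cuts_spec {t : PBT} {c : Cut} (h : c ∈ cuts t) :
    c.1.1.numNodes + c.1.2.numNodes = t.numNodes ∧ c.2 ∈ strands t.numNodes := by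
  induction t generalizing c with
  | nil => simp_all
  | node _ l r ihl ihr =>
    rw [cuts_node, mem_add, mem_singleton] at h
    obtain rfl | h := h
    · simp
    · simp only [nodeCuts, mem_bind, mem_map] at h
      obtain ⟨a, ha, b, hb, u, hu, rfl⟩ := h
      obtain ⟨ha₁, ha₂⟩ := ihl ha
      obtain ⟨hb₁, hb₂⟩ := ihr hb
      have hu := numNodes_of_mem_mulTrees hu
      simp only [numNodes_node]
      refine ⟨by omega, mul_mem (mul_mem ?_ ?_) ?_⟩
      · exact shift_mem_strands (blk_mem_strands le_rfl) (by omega)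
      · exact strands_mono (by omega) ha₂
      · exact shift_mem_strands hb₂ (by omega)

/-- The terms of the product of two terms of the coproducts of trees, the first one having `m`
vertices. -/
def mulCuts (m : ℕ) (c d : Cut) : Multiset Cut :=
  (mulTrees c.1.1 d.1.1).bind fun u => (mulTrees c.1.2 d.1.2).map fun v =>
    ((u, v), shift c.1.1.numNodes (blk c.1.2.numNodes d.1.1.numNodes) * c.2 * shift m d.2)

/-- The part of the product of two coproducts in which the root of the second leg stems from the
first factor. -/
def mulCutsLeft (l r : PBT) (T : Multiset Cut) : Multiset Cut :=
  (cuts l).bind fun a => (cuts r).bind fun b => (mulTrees a.1.1 b.1.1).bind fun y =>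
    T.bind fun d => (mulTrees y d.1.1).bind fun x => (mulTrees b.1.2 d.1.2).map fun v =>
      ((x, .node () a.1.2 v),
        shift y.numNodes (blk (a.1.2.numNodes + b.1.2.numNodes + 1) d.1.1.numNodes) *
          (shift a.1.1.numNodes (blk (a.1.2.numNodes + 1) b.1.1.numNodes) * a.2 *
            shift (l.numNodes + 1) b.2) * shift (l.numNodes + r.numNodes + 1) d.2)

/-- The part of the product of two coproducts in which the root of the second leg stems from the
second factor. -/
def mulCutsRight (m : ℕ) (S : Multiset Cut) (l r : PBT) : Multiset Cut :=
  S.bind fun c => (cuts l).bind fun a => (cuts r).bind fun b =>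
    (mulTrees a.1.1 b.1.1).bind fun y => (mulTrees c.1.1 y).bind fun x =>
      (mulTrees c.1.2 a.1.2).map fun v =>
      ((x, .node () v b.1.2),
        shift c.1.1.numNodes (blk c.1.2.numNodes y.numNodes) * c.2 *
          shift m (shift a.1.1.numNodes (blk (a.1.2.numNodes + 1) b.1.1.numNodes) * a.2 *
            shift (l.numNodes + 1) b.2))

/-- The summand `Y₁ ∨ (Y₂ * Y')` of the product accounts for the terms whose second leg has its root
from the first factor. `T` in `mulCutsLeft` is left free because the full coproduct of `Y'` will be
split into its two parts. -/
theorem bind_nodeCuts_left (l r t : PBT)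
    (ih : (mulTrees r t).bind cuts =
      (cuts r).bind fun c => (cuts t).bind fun d => mulCuts r.numNodes c d) :
    ((mulTrees r t).bind fun u => nodeCuts l.numNodes (cuts l) (cuts u)) =
      mulCutsLeft l r (cuts t) := by
  have h₀ : ((mulTrees r t).bind fun u => nodeCuts l.numNodes (cuts l) (cuts u)) =
      nodeCuts l.numNodes (cuts l) ((mulTrees r t).bind cuts) := by
    simp only [nodeCuts, Multiset.bind_assoc]
    rw [bind_bind]
  rw [h₀, ih, nodeCuts, mulCutsLeft]
  refine bind_congr fun a ha => ?_
  rw [Multiset.bind_assoc]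
  refine bind_congr fun b hb => ?_
  rw [Multiset.bind_assoc, bind_bind]
  refine bind_congr fun d hd => ?_
  obtain ⟨ha₁, ha₂⟩ := cuts_spec ha
  -- The triple product of first legs, now bracketed to the left. The braid can be written without
  -- the intermediate tree, since it depends on that tree only through its number of vertices.
  trans ((mulTrees a.1.1 b.1.1).bind (mulTrees · d.1.1)).bind fun x =>
    (mulTrees b.1.2 d.1.2).map fun v => ((x, .node () a.1.2 v),
      shift (a.1.1.numNodes + b.1.1.numNodes)
          (blk (a.1.2.numNodes + b.1.2.numNodes + 1) d.1.1.numNodes) *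
        (shift a.1.1.numNodes (blk (a.1.2.numNodes + 1) b.1.1.numNodes) * a.2 *
          shift (l.numNodes + 1) b.2) * shift (l.numNodes + r.numNodes + 1) d.2)
  · rw [mulTrees_assoc, mulCuts, Multiset.bind_assoc, Multiset.bind_assoc]
    refine bind_congr fun u hu => ?_
    rw [Multiset.bind_map, bind_map_comm]
    have hu := numNodes_of_mem_mulTrees hu
    refine bind_congr fun x hx => map_congr rfl fun v hv => ?_
    -- Once all block crossings are split, the two braids differ only in the place of the crossing
    -- of the second leg of `b` with the first leg of `d`. It slides past `a.2` and past the
    -- crossing with the first leg of `b`, both of which lie on strands further left.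
    have h₁ : blk (a.1.2.numNodes + b.1.2.numNodes + 1) d.1.1.numNodes =
        blk (a.1.2.numNodes + 1) d.1.1.numNodes *
          shift (a.1.2.numNodes + 1) (blk b.1.2.numNodes d.1.1.numNodes) := by
      rw [← blk_add_left, add_right_comm]
    have h₂ : a.2 * shift (l.numNodes + 1 + b.1.1.numNodes)
          (blk b.1.2.numNodes d.1.1.numNodes) =
        shift (l.numNodes + 1 + b.1.1.numNodes) (blk b.1.2.numNodes d.1.1.numNodes) * a.2 :=
      mul_shift_comm ha₂ (by omega) _
    have h₃ : shift a.1.1.numNodes (blk (a.1.2.numNodes + 1) b.1.1.numNodes) *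
          shift (l.numNodes + 1 + b.1.1.numNodes) (blk b.1.2.numNodes d.1.1.numNodes) =
        shift (l.numNodes + 1 + b.1.1.numNodes) (blk b.1.2.numNodes d.1.1.numNodes) *
          shift a.1.1.numNodes (blk (a.1.2.numNodes + 1) b.1.1.numNodes) :=
      mul_shift_comm (shift_mem_strands (blk_mem_strands le_rfl) le_rfl) (by omega) _
    have e₁ : a.1.1.numNodes + b.1.1.numNodes + (a.1.2.numNodes + 1) =
      l.numNodes + 1 + b.1.1.numNodes := by omega
    have e₂ : l.numNodes + 1 + r.numNodes = l.numNodes + r.numNodes + 1 := by omega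
    refine Prod.ext rfl ?_
    simp only [hu, h₁, blk_add_right, map_mul, shift_shift, e₁, e₂]
    simp only [mul_assoc]
    rw [← mul_assoc a.2, h₂, mul_assoc, ← mul_assoc (shift a.1.1.numNodes _), h₃, mul_assoc]
  · rw [Multiset.bind_assoc]
    refine bind_congr fun y hy => ?_
    rw [numNodes_of_mem_mulTrees hy]

/-- Mirror image of `bind_nodeCuts_left`, for the summand `(Y * Y'₁) ∨ Y'₂` and the roots coming
from the second factor. -/
theorem bind_nodeCuts_right (s l r : PBT)
    (ih : (mulTrees s l).bind cuts =
      (cuts s).bind fun c => (cuts l).bind fun d => mulCuts s.numNodes c d) :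
    ((mulTrees s l).bind fun u => nodeCuts u.numNodes (cuts u) (cuts r)) =
      mulCutsRight s.numNodes (cuts s) l r := by
  have h₀ : ((mulTrees s l).bind fun u => nodeCuts u.numNodes (cuts u) (cuts r)) =
      nodeCuts (s.numNodes + l.numNodes) ((mulTrees s l).bind cuts) (cuts r) := by
    simp only [nodeCuts, Multiset.bind_assoc]
    refine bind_congr fun u hu => ?_
    rw [numNodes_of_mem_mulTrees hu]
  rw [h₀, ih, nodeCuts, mulCutsRight, Multiset.bind_assoc]
  refine bind_congr fun c hc => ?_
  rw [Multiset.bind_assoc]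
  refine bind_congr fun a ha => ?_
  rw [mulCuts, bind_bind]
  refine bind_congr fun b hb => ?_
  obtain ⟨hc₁, hc₂⟩ := cuts_spec hc
  obtain ⟨ha₁, ha₂⟩ := cuts_spec ha
  trans ((mulTrees a.1.1 b.1.1).bind (mulTrees c.1.1 ·)).bind fun x =>
    (mulTrees c.1.2 a.1.2).map fun v => ((x, .node () v b.1.2),
        shift c.1.1.numNodes (blk c.1.2.numNodes (a.1.1.numNodes + b.1.1.numNodes)) * c.2 *
          shift s.numNodes (shift a.1.1.numNodes (blk (a.1.2.numNodes + 1) b.1.1.numNodes) * a.2 *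
            shift (l.numNodes + 1) b.2))
  · rw [← mulTrees_assoc, Multiset.bind_assoc, Multiset.bind_assoc]
    refine bind_congr fun u hu => ?_
    rw [Multiset.bind_map, bind_map_comm]
    have hu := numNodes_of_mem_mulTrees hu
    refine bind_congr fun v hv => map_congr rfl fun x hx => ?_
    have hv := numNodes_of_mem_mulTrees hv
    -- Here the crossing to be moved is that of the second leg of `a`, together with the root, past
    -- the first leg of `b`. It is disjoint from `c.2` and from the crossing of the second leg of
    -- `c` with the first leg of `a`.
    have h₁ : blk (v.numNodes + 1) b.1.1.numNodes =
        blk c.1.2.numNodes b.1.1.numNodes *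
          shift c.1.2.numNodes (blk (a.1.2.numNodes + 1) b.1.1.numNodes) := by
      rw [← blk_add_left, hv, add_assoc]
    have h₂ : c.2 * shift (s.numNodes + a.1.1.numNodes)
          (blk (a.1.2.numNodes + 1) b.1.1.numNodes) =
        shift (s.numNodes + a.1.1.numNodes) (blk (a.1.2.numNodes + 1) b.1.1.numNodes) * c.2 :=
      mul_shift_comm hc₂ (by omega) _
    have h₃ : shift c.1.1.numNodes (blk c.1.2.numNodes a.1.1.numNodes) *
          shift (s.numNodes + a.1.1.numNodes) (blk (a.1.2.numNodes + 1) b.1.1.numNodes) =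
        shift (s.numNodes + a.1.1.numNodes) (blk (a.1.2.numNodes + 1) b.1.1.numNodes) *
          shift c.1.1.numNodes (blk c.1.2.numNodes a.1.1.numNodes) :=
      mul_shift_comm (shift_mem_strands (blk_mem_strands le_rfl) le_rfl) (by omega) _
    have e₁ : c.1.1.numNodes + a.1.1.numNodes + c.1.2.numNodes =
      s.numNodes + a.1.1.numNodes := by omega
    refine Prod.ext rfl ?_
    simp only [hu, h₁, blk_add_right, map_mul, shift_shift, e₁]
    simp only [mul_assoc]
    rw [← mul_assoc c.2 (shift _ (blk _ _)), h₂, mul_assoc (shift _ _) c.2,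
      ← mul_assoc (shift c.1.1.numNodes _) (shift (s.numNodes + _) _), h₃, mul_assoc,
      add_assoc s.numNodes]
  · rw [Multiset.bind_assoc]
    refine bind_congr fun y hy => ?_
    rw [numNodes_of_mem_mulTrees hy]

/-- The coproduct of trees is multiplicative. -/
theorem mulTrees_bind_cuts (s t : PBT) :
    (mulTrees s t).bind cuts =
      (cuts s).bind fun c => (cuts t).bind fun d => mulCuts s.numNodes c d := by
  induction s, t using mulTrees.induct with
  | case1 t => simp [mulCuts, bind_singleton_self]
  | case2 _ l r => simp [mulCuts, bind_singleton_self]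
  | case3 _ l r _ l' r' ih₁ ih₂ =>
    have h₁ := bind_nodeCuts_left l r _ ih₁
    have h₂ := bind_nodeCuts_right _ l' r' ih₂
    -- The product of two coproducts has four parts. When both second legs have a root, their
    -- product splits by the factor that supplies the new root (`h₃`). If exactly one second leg is
    -- `|`, the root has only one possible origin (`h₄`, `h₅`); if both are, the undivided product
    -- remains (`h₆`).
    have h₃ : ((nodeCuts l.numNodes (cuts l) (cuts r)).bind fun c =>
          (nodeCuts l'.numNodes (cuts l') (cuts r')).bind fun d =>
            mulCuts (BinaryTree.node () l r).numNodes c d) =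
        mulCutsLeft l r (nodeCuts l'.numNodes (cuts l') (cuts r')) +
          mulCutsRight (BinaryTree.node () l r).numNodes (nodeCuts l.numNodes (cuts l) (cuts r))
            l' r' := by
      simp only [mulCuts, mulCutsLeft, mulCutsRight, nodeCuts, Multiset.bind_assoc, Multiset.bind_map,
        node_mulTrees_node, Multiset.map_add, map_map, bind_add, Function.comp_def, numNodes_node]
    have h₄ : ((nodeCuts l.numNodes (cuts l) (cuts r)).bind fun c =>
          mulCuts (BinaryTree.node () l r).numNodes c ((.node () l' r', .nil), 1)) =
        mulCutsLeft l r {((.node () l' r', .nil), 1)} := by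
      simp only [mulCuts, mulCutsLeft, nodeCuts, Multiset.bind_assoc, Multiset.bind_map, mulTrees_nil,
        map_singleton, singleton_bind, bind_singleton, numNodes_node]
    have h₅ : ((nodeCuts l'.numNodes (cuts l') (cuts r')).bind fun d =>
          mulCuts (BinaryTree.node () l r).numNodes ((.node () l r, .nil), 1) d) =
        mulCutsRight (BinaryTree.node () l r).numNodes {((.node () l r, .nil), 1)} l' r' := by
      simp only [mulCuts, mulCutsRight, nodeCuts, Multiset.bind_assoc, Multiset.bind_map, nil_mulTrees,
        map_singleton, singleton_bind, bind_singleton, numNodes_node]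
    change (mulTrees (.node () l r) (.node () l' r')).bind cuts =
      (cuts (.node () l r)).bind fun c => (cuts (.node () l' r')).bind fun d =>
        mulCuts (BinaryTree.node () l r).numNodes c d
    have hL (T T') : mulCutsLeft l r (T + T') = mulCutsLeft l r T + mulCutsLeft l r T' := by
      simp only [mulCutsLeft, add_bind, bind_add]
    have hR (m S S') : mulCutsRight m (S + S') l' r' =
        mulCutsRight m S l' r' + mulCutsRight m S' l' r' := by
      simp only [mulCutsRight, add_bind]
    simp only [cuts_node l r, cuts_node l' r', add_bind, bind_add, singleton_bind, h₃, h₄, h₅]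
    rw [cuts_node, hL] at h₁
    rw [cuts_node, hR] at h₂
    have h₆ : mulCuts (BinaryTree.node () l r).numNodes ((.node () l r, .nil), 1)
          ((.node () l' r', .nil), 1) =
        (mulTrees (.node () l r) (.node () l' r')).map fun u => ((u, .nil), 1) := by
      simp [mulCuts, bind_singleton]
    rw [h₆]
    simp only [node_mulTrees_node, add_bind, Multiset.bind_map, cuts_node, bind_add, h₁, h₂,
      bind_singleton, Multiset.map_add, map_map, Function.comp_def]
    abel

/-! ### Coassociativity. -/

/-- The terms of the iterated coproduct in which the first leg is split. -/
def coassocLeft (t : PBT) : Multiset ((PBT × (PBT × PBT)) × PosBraid) :=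
  (cuts t).bind fun c => (cuts c.1.1).map fun d => ((d.1.1, (d.1.2, c.1.2)), d.2 * c.2)

/-- The terms of the iterated coproduct in which the second leg is split. -/
def coassocRight (t : PBT) : Multiset ((PBT × (PBT × PBT)) × PosBraid) :=
  (cuts t).bind fun c => (cuts c.1.2).map fun d =>
    ((c.1.1, (d.1.1, d.1.2)), shift c.1.1.numNodes d.2 * c.2)

/-- The terms of the iterated coproduct of a grafted tree in terms of those of the two branches. -/
def nodeIterCuts (m : ℕ) (L R : Multiset ((PBT × (PBT × PBT)) × PosBraid)) :
    Multiset ((PBT × (PBT × PBT)) × PosBraid) :=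
  L.bind fun p => R.bind fun q =>
    (mulTrees p.1.1 q.1.1).bind fun u => (mulTrees p.1.2.1 q.1.2.1).map fun v =>
      ((u, (v, .node () p.1.2.2 q.1.2.2)),
        shift p.1.1.numNodes (blk p.1.2.1.numNodes q.1.1.numNodes) *
          shift (p.1.1.numNodes + p.1.2.1.numNodes)
            (blk (p.1.2.2.numNodes + 1) (q.1.1.numNodes + q.1.2.1.numNodes)) *
          p.2 * shift (m + 1) q.2)

/-- The first leg to be split is a product of first legs of the branches, so multiplicativity splits
each factor separately. It remains to bring the new braids next to those of their own branches. -/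
theorem coassocLeft_node (l r : PBT) : coassocLeft (.node () l r) =
    (cuts (.node () l r)).map (fun d => ((d.1.1, (d.1.2, .nil)), d.2)) +
      nodeIterCuts l.numNodes (coassocLeft l) (coassocLeft r) := by
  rw [coassocLeft, cuts_node, add_bind, singleton_bind, ← cuts_node]
  simp only [mul_one]
  congr 1
  simp only [nodeCuts, nodeIterCuts, coassocLeft, Multiset.bind_assoc, Multiset.bind_map]
  refine bind_congr fun a ha => ?_
  rw [bind_bind (cuts a.1.1)]
  refine bind_congr fun b hb => ?_
  obtain ⟨ha₁, ha₂⟩ := cuts_spec ha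
  obtain ⟨hb₁, hb₂⟩ := cuts_spec hb
  have h := congrArg (map fun d : Cut => ((d.1.1, (d.1.2, BinaryTree.node () a.1.2 b.1.2)),
    d.2 * (shift a.1.1.numNodes (blk (a.1.2.numNodes + 1) b.1.1.numNodes) * a.2 *
      shift (l.numNodes + 1) b.2))) (mulTrees_bind_cuts a.1.1 b.1.1)
  simp only [Multiset.map_bind, mulCuts, map_map, Function.comp_def] at h
  rw [h]
  refine bind_congr fun a' ha' => bind_congr fun b' hb' => bind_congr fun u hu =>
    map_congr rfl fun v hv => Prod.ext rfl ?_
  obtain ⟨ha'₁, ha'₂⟩ := cuts_spec ha'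
  obtain ⟨hb'₁, hb'₂⟩ := cuts_spec hb'
  -- The braid of `b'` lies inside the block being crossed, so naturality carries it through the
  -- crossing and it then passes `a.2` by disjointness (`h₃`). The braid of `a'` lies wholly to the
  -- left of that crossing (`h₂`).
  have h₁ : shift a.1.1.numNodes b'.2 *
        shift a.1.1.numNodes (blk (a.1.2.numNodes + 1) b.1.1.numNodes) =
      shift a.1.1.numNodes (blk (a.1.2.numNodes + 1) b.1.1.numNodes) *
        shift (l.numNodes + 1) b'.2 := by
    rw [← map_mul, ← blk_mul_shift hb'₂, map_mul, shift_shift, ← add_assoc, ha₁]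
  have h₂ := mul_shift_comm ha'₂ le_rfl (blk (a.1.2.numNodes + 1) b.1.1.numNodes)
  have h₃ := mul_shift_comm ha₂ (Nat.le_succ _) b'.2
  simp only [ha'₁, hb'₁, map_mul, mul_assoc]
  rw [← mul_assoc (shift a.1.1.numNodes b'.2), h₁, mul_assoc, ← mul_assoc a'.2, h₂, mul_assoc,
    ← mul_assoc a.2, h₃, mul_assoc]

/-- The second leg to be split is either `|` or a grafted tree, whose coproduct is known by
recursion. The undivided terms make up the rest of the first summand, and the other terms form the
iterated coproducts of the branches. -/
theorem coassocRight_node (l r : PBT) : coassocRight (.node () l r) =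
    (cuts (.node () l r)).map (fun d => ((d.1.1, (d.1.2, .nil)), d.2)) +
      nodeIterCuts l.numNodes (coassocRight l) (coassocRight r) := by
  have h₀ : ((nodeCuts l.numNodes (cuts l) (cuts r)).bind fun c => (cuts c.1.2).map fun d =>
        ((c.1.1, (d.1.1, d.1.2)), shift c.1.1.numNodes d.2 * c.2)) =
      (nodeCuts l.numNodes (cuts l) (cuts r)).map (fun d => ((d.1.1, (d.1.2, .nil)), d.2)) +
      nodeIterCuts l.numNodes (coassocRight l) (coassocRight r) := by
    simp only [nodeCuts, Multiset.bind_assoc, Multiset.bind_map, cuts_node, Multiset.map_add,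
      bind_add, map_singleton, Multiset.map_bind, map_map, bind_singleton, Function.comp_def,
      map_one, one_mul]
    congr 1
    simp only [nodeIterCuts, coassocRight, Multiset.bind_assoc, Multiset.bind_map]
    refine bind_congr fun a ha => ?_
    rw [bind_bind (cuts a.1.2)]
    refine bind_congr fun b hb => ?_
    rw [bind_bind]
    refine bind_congr fun a' ha' => ?_
    rw [bind_bind]
    refine bind_congr fun b' hb' => bind_congr fun u hu => map_congr rfl fun v hv =>
      Prod.ext rfl ?_
    obtain ⟨ha₁, ha₂⟩ := cuts_spec ha
    obtain ⟨ha'₁, ha'₂⟩ := cuts_spec ha'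
    have hu := numNodes_of_mem_mulTrees hu
    -- The braid of `a'` lies inside the block that moves right, so it passes the crossing by
    -- naturality in the first block. `h₅` then splits that block according to the cut `a'` of the
    -- second leg of `a`; the remaining exchanges are between disjoint strands.
    have h₁ : shift (a.1.1.numNodes + b.1.1.numNodes) a'.2 *
          shift a.1.1.numNodes (blk (a.1.2.numNodes + 1) b.1.1.numNodes) =
        shift a.1.1.numNodes (blk (a.1.2.numNodes + 1) b.1.1.numNodes) *
          shift a.1.1.numNodes a'.2 := by
      rw [← shift_shift, ← map_mul, ← blk_mul (strands_mono (Nat.le_succ _) ha'₂), map_mul]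
    have h₂ : shift a.1.1.numNodes (blk (a.1.2.numNodes + 1) b.1.1.numNodes) *
          shift (l.numNodes + 1 + b.1.1.numNodes) b'.2 =
        shift (l.numNodes + 1 + b.1.1.numNodes) b'.2 *
          shift a.1.1.numNodes (blk (a.1.2.numNodes + 1) b.1.1.numNodes) :=
      mul_shift_comm (shift_mem_strands (blk_mem_strands le_rfl) le_rfl) (by omega) _
    have h₃ : shift a.1.1.numNodes a'.2 * a.2 * shift (l.numNodes + 1 + b.1.1.numNodes) b'.2 =
        shift (l.numNodes + 1 + b.1.1.numNodes) b'.2 * (shift a.1.1.numNodes a'.2 * a.2) :=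
      mul_shift_comm (mul_mem (shift_mem_strands ha'₂ ha₁.le) ha₂) (by omega) _
    have h₄ : shift a.1.1.numNodes (blk a'.1.1.numNodes b.1.1.numNodes) *
          shift (a.1.1.numNodes + b.1.1.numNodes + a'.1.1.numNodes)
            (blk (a'.1.2.numNodes + 1) b'.1.1.numNodes) =
        shift (a.1.1.numNodes + b.1.1.numNodes + a'.1.1.numNodes)
            (blk (a'.1.2.numNodes + 1) b'.1.1.numNodes) *
          shift a.1.1.numNodes (blk a'.1.1.numNodes b.1.1.numNodes) :=
      mul_shift_comm (shift_mem_strands (blk_mem_strands le_rfl) le_rfl) (by omega) _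
    have h₅ : shift a.1.1.numNodes (blk (a.1.2.numNodes + 1) b.1.1.numNodes) =
        shift a.1.1.numNodes (blk a'.1.1.numNodes b.1.1.numNodes) *
          shift (a.1.1.numNodes + a'.1.1.numNodes)
            (blk (a'.1.2.numNodes + 1) b.1.1.numNodes) := by
      rw [← shift_shift, ← map_mul, ← blk_add_left, ← add_assoc, ha'₁]
    have e₁ : a.1.1.numNodes + b.1.1.numNodes + (a.1.2.numNodes + 1) =
      l.numNodes + 1 + b.1.1.numNodes := by omega
    have e₂ : a.1.1.numNodes + a'.1.1.numNodes + b.1.1.numNodes =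
      a.1.1.numNodes + b.1.1.numNodes + a'.1.1.numNodes := by omega
    simp only [hu, map_mul, shift_shift, blk_add_right, e₁, e₂]
    set X := shift (l.numNodes + 1 + b.1.1.numNodes) b'.2
    set Y := shift (l.numNodes + 1) b.2
    set P := shift a.1.1.numNodes (blk (a.1.2.numNodes + 1) b.1.1.numNodes)
    set Q := shift (a.1.1.numNodes + b.1.1.numNodes + a'.1.1.numNodes)
            (blk (a'.1.2.numNodes + 1) b'.1.1.numNodes)
    set A := shift a.1.1.numNodes a'.2
    calc _ = Q * shift (a.1.1.numNodes + b.1.1.numNodes) a'.2 * (X * P) * a.2 * Y := by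
          simp only [mul_assoc]
      _ = Q * (shift (a.1.1.numNodes + b.1.1.numNodes) a'.2 * P) * X * a.2 * Y := by
          rw [← h₂]; simp only [mul_assoc]
      _ = Q * P * A * (X * a.2) * Y := by rw [h₁]; simp only [mul_assoc]
      _ = Q * P * (A * a.2 * X) * Y := by
          rw [← mul_shift_comm ha₂ (by omega)]; simp only [mul_assoc, X]
      _ = _ := by rw [h₅, ← mul_assoc Q, ← h₄]; simp only [mul_assoc]
  rw [coassocRight, cuts_node, add_bind, singleton_bind, h₀, Multiset.map_add, add_assoc]
  simp

/-- The coproduct of trees is coassociative. -/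
theorem coassocLeft_eq_coassocRight (t : PBT) : coassocLeft t = coassocRight t := by
  induction t with
  | nil => simp [coassocLeft, coassocRight]
  | node u l r ihl ihr =>
    exact (coassocLeft_node l r).trans (by rw [ihl, ihr]; exact (coassocRight_node l r).symm)

/-! ### The counit on trees. -/

/-- The value of the counit on a tree. -/
def counitTrees : PBT → Multiset (Unit × PosBraid)
  | .nil => {((), 1)}
  | .node _ _ _ => 0

@[simp]
theorem counitTrees_nil : counitTrees .nil = {((), 1)} := rfl

@[simp]
theorem counitTrees_node (u : Unit) (l r : PBT) : counitTrees (.node u l r) = 0 := rfl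

theorem counitTrees_eq_zero {t : PBT} (h : t.numNodes ≠ 0) : counitTrees t = 0 := by
  cases t with
  | nil => exact absurd rfl h
  | node => rfl

/-- Vertices add up in a product, so `|` occurs only in `| * |`. The free function `f` lets the
identity be used inside sums that carry further data. -/
theorem mulTrees_bind_counitTrees (s t : PBT) {α : Type*} (f : PBT → Unit × PosBraid → α) :
    ((mulTrees s t).bind fun u => (counitTrees u).map (f u)) =
      (counitTrees s).bind fun _ => (counitTrees t).map (f .nil) := by
  cases s with
  | nil => cases t <;> simp
  | node u l r =>
    rw [counitTrees_node, zero_bind, ← bind_zero]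
    refine bind_congr fun v hv => ?_
    have hv := numNodes_of_mem_mulTrees hv
    rw [counitTrees_eq_zero (by rw [hv, numNodes_node]; omega), map_zero]

theorem cuts_counit_right (t : PBT) :
    ((cuts t).bind fun c => (counitTrees c.1.2).map fun _ => (c.1.1, c.2)) = {(t, 1)} := by
  cases t with
  | nil => simp
  | node u l r =>
    rw [cuts_node, add_bind, nodeCuts]
    simp [Multiset.bind_assoc, Multiset.bind_map]

/-- A product of first legs is `|` only if both are, and then there is nothing to cross; hence the
sum for a grafted tree factors through those of its branches. The undivided term contributes nothing
here, in contrast to the right counit, where it is the only one to survive. -/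
theorem cuts_counit_left (t : PBT) :
    ((cuts t).bind fun c => (counitTrees c.1.1).map fun _ => (c.1.2, c.2)) = {(t, 1)} := by
  induction t with
  | nil => simp
  | node u l r ihl ihr =>
    have h : ((nodeCuts l.numNodes (cuts l) (cuts r)).bind fun c =>
          (counitTrees c.1.1).map fun _ => (c.1.2, c.2)) =
        ((cuts l).bind fun c => (counitTrees c.1.1).map fun _ => (c.1.2, c.2)).bind fun p =>
          ((cuts r).bind fun c => (counitTrees c.1.1).map fun _ => (c.1.2, c.2)).map fun q =>
            (.node () p.1 q.1, p.2 * shift (l.numNodes + 1) q.2) := by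
      simp only [nodeCuts, Multiset.bind_assoc, Multiset.bind_map, Multiset.map_bind, map_map,
        Function.comp_def]
      refine bind_congr fun a _ => ?_
      rw [bind_bind]
      refine bind_congr fun b _ => ?_
      rw [mulTrees_bind_counitTrees (f := fun _ _ => _)]
      rcases a with ⟨⟨_ | _, _⟩, _⟩ <;> rcases b with ⟨⟨_ | _, _⟩, _⟩ <;> simp
    rw [ihl, ihr] at h
    rw [cuts_node, add_bind, h]
    simp

end StructureConstants

/-! ### The action of the positive braid monoid on the tensor algebra -/

section TensorAction

variable {k : Type*} [CommSemiring k] {V : Type*} [AddCommMonoid V] [Module k V]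

local notation "𝕋" => TensorAlgebra k V

variable (k V) in
/-- The inclusion of a tensor power into the tensor algebra. -/
abbrev toTA (n : ℕ) : ⨂[k]^n V →ₗ[k] 𝕋 := TensorPower.toTensorAlgebra

theorem toDirectSum_toTA (n : ℕ) (a : ⨂[k]^n V) :
    TensorAlgebra.toDirectSum (toTA k V n a) = DirectSum.lof k ℕ (fun n => ⨂[k]^n V) n a := by
  have h : TensorAlgebra.ofDirectSum (DirectSum.lof k ℕ (fun n => ⨂[k]^n V) n a) = toTA k V n a :=
    DirectSum.toAddMonoid_of (fun _ ↦ LinearMap.toAddMonoidHom TensorPower.toTensorAlgebra) _ _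
  rw [← h, TensorAlgebra.toDirectSum_ofDirectSum]

variable (k V) in
/-- The homogeneous component of degree `n`. -/
def homogComponent (n : ℕ) : 𝕋 →ₗ[k] ⨂[k]^n V :=
  DirectSum.component k ℕ (fun n => ⨂[k]^n V) n ∘ₗ TensorAlgebra.toDirectSum.toLinearMap

@[simp]
theorem homogComponent_toTA (n : ℕ) (a : ⨂[k]^n V) :
    homogComponent k V n (toTA k V n a) = a := by
  simp [homogComponent, toDirectSum_toTA, DirectSum.component.lof_self]

theorem toTA_mulEquiv {m n : ℕ} (a : ⨂[k]^m V) (b : ⨂[k]^n V) :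
    toTA k V (m + n) (TensorPower.mulEquiv (a ⊗ₜ b)) = toTA k V m a * toTA k V n b :=
  TensorPower.toTensorAlgebra_gMul a b

theorem toTA_cast {m n : ℕ} (h : m = n) (a : ⨂[k]^m V) :
    toTA k V n (TensorPower.cast k V h a) = toTA k V m a := by
  subst h; simp

theorem toTA_oneEquiv (v : V) : toTA k V 1 (oneEquiv k V v) = TensorAlgebra.ι k v := by
  simp [toTA, oneEquiv]

theorem toTA_algebraMap₀ (c : k) :
    toTA k V 0 (TensorPower.algebraMap₀ c) = algebraMap k 𝕋 c :=
  TensorPower.toTensorAlgebra_galgebra_toFun c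

variable (k V) in
/-- The homogeneous elements of degree `n`. -/
def homog (n : ℕ) : Submodule k 𝕋 := LinearMap.range (toTA k V n)

theorem toTA_mem (n : ℕ) (a : ⨂[k]^n V) : toTA k V n a ∈ homog k V n := ⟨a, rfl⟩

theorem ι_mem (v : V) : TensorAlgebra.ι k v ∈ homog k V 1 := ⟨_, toTA_oneEquiv v⟩

theorem one_mem_homog : (1 : 𝕋) ∈ homog k V 0 :=
  ⟨TensorPower.algebraMap₀ 1, by rw [toTA_algebraMap₀, map_one]⟩

theorem mul_mem_homog {m n : ℕ} {a b : 𝕋} (ha : a ∈ homog k V m) (hb : b ∈ homog k V n) :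
    a * b ∈ homog k V (m + n) := by
  obtain ⟨a, rfl⟩ := ha
  obtain ⟨b, rfl⟩ := hb
  exact ⟨_, toTA_mulEquiv a b⟩

theorem eq_of_homog {M : Type*} [AddCommMonoid M] [Module k M] {f g : 𝕋 →ₗ[k] M}
    (h : ∀ n, ∀ x ∈ homog k V n, f x = g x) : f = g := by
  have h' : f ∘ₗ TensorAlgebra.ofDirectSum.toLinearMap =
      g ∘ₗ TensorAlgebra.ofDirectSum.toLinearMap := by
    refine DirectSum.linearMap_ext _ fun n => LinearMap.ext fun a => ?_
    have e : TensorAlgebra.ofDirectSum (DirectSum.lof k ℕ (fun n => ⨂[k]^n V) n a) =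
        toTA k V n a := by
      rw [← toDirectSum_toTA, TensorAlgebra.ofDirectSum_toDirectSum]
    simpa [e] using h n _ (toTA_mem n a)
  refine LinearMap.ext fun x => ?_
  simpa using LinearMap.congr_fun h' (TensorAlgebra.toDirectSum x)

theorem homog_add_le {m n : ℕ} {N : Submodule k 𝕋}
    (h : ∀ a ∈ homog k V m, ∀ b ∈ homog k V n, a * b ∈ N) : homog k V (m + n) ≤ N := by
  rintro _ ⟨x, rfl⟩
  obtain ⟨y, rfl⟩ := (TensorPower.mulEquiv (R := k) (M := V) (n := m) (m := n)).surjective x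
  induction y using TensorProduct.induction_on with
  | zero => simp
  | add y z hy hz => simp only [map_add]; exact add_mem hy hz
  | tmul a b => rw [toTA_mulEquiv]; exact h _ (toTA_mem _ _) _ (toTA_mem _ _)

/-- Linear maps on homogeneous elements of degree `m + n` are determined by their values on
products. -/
theorem eq_of_homog_mul {M : Type*} [AddCommMonoid M] [Module k M] {f g : 𝕋 →ₗ[k] M} {m n : ℕ}
    (h : ∀ a ∈ homog k V m, ∀ b ∈ homog k V n, f (a * b) = g (a * b)) {x : 𝕋}
    (hx : x ∈ homog k V (m + n)) : f x = g x :=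
  homog_add_le (N := LinearMap.eqLocus f g) h hx

variable (k V) in
/-- The product `V ⊗ V → V^{⊗2}` in the tensor algebra. -/
def ιTwo : V ⊗[k] V →ₗ[k] 𝕋 := toTA k V 2 ∘ₗ (twoEquiv k V).toLinearMap

theorem ιTwo_tmul (u v : V) :
    ιTwo k V (u ⊗ₜ v) = TensorAlgebra.ι k u * TensorAlgebra.ι k v := by
  rw [← toTA_oneEquiv, ← toTA_oneEquiv, ← toTA_mulEquiv]; rfl

theorem exists_ιTwo {x : 𝕋} (hx : x ∈ homog k V 2) : ∃ z, ιTwo k V z = x := by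
  obtain ⟨a, rfl⟩ := hx
  exact ⟨(twoEquiv k V).symm a, by simp [ιTwo]⟩

theorem exists_ι {x : 𝕋} (hx : x ∈ homog k V 1) : ∃ v, TensorAlgebra.ι k v = x := by
  obtain ⟨a, rfl⟩ := hx
  exact ⟨(oneEquiv k V).symm a, by rw [← toTA_oneEquiv]; simp⟩

theorem toTA_insertTwo {i j : ℕ} (a : ⨂[k]^i V) (z : V ⊗[k] V) (b : ⨂[k]^j V) :
    toTA k V (i + 2 + j) (insertTwo k V i j ((a ⊗ₜ z) ⊗ₜ b)) =
      toTA k V i a * ιTwo k V z * toTA k V j b := by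
  simp only [insertTwo, LinearEquiv.trans_apply, TensorProduct.congr_tmul,
    LinearEquiv.refl_apply, toTA_mulEquiv]
  rfl

variable (σ : V ⊗[k] V →ₗ[k] V ⊗[k] V)

theorem sigmaAt_insertTwo (i j : ℕ) (x : (⨂[k]^i V ⊗[k] (V ⊗[k] V)) ⊗[k] ⨂[k]^j V) :
    sigmaAt σ (i + 2 + j) i (insertTwo k V i j x) =
      insertTwo k V i j ((σ.lTensor (⨂[k]^i V)).rTensor (⨂[k]^j V) x) := by
  -- `sigmaAt` reads off the number of trailing letters as `n - (i + 2)`, which agrees with `j` only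
  -- propositionally; a free degree `n` allows `j` to be substituted.
  have key : ∀ n j (h : i + 2 + j = n) (x : (⨂[k]^i V ⊗[k] (V ⊗[k] V)) ⊗[k] ⨂[k]^j V),
      sigmaAt σ n i (TensorPower.cast k V h (insertTwo k V i j x)) =
        TensorPower.cast k V h
          (insertTwo k V i j ((σ.lTensor (⨂[k]^i V)).rTensor (⨂[k]^j V) x)) := by
    intro n j h x
    obtain rfl : j = n - (i + 2) := by omega
    rw [sigmaAt, dif_pos h]
    simp [LinearEquiv.conj_apply]
  simpa using key _ j rfl x

/-- The operator on the tensor algebra that applies `σ` in the positions `i`, `i + 1`, and vanishes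
in degrees less than `i + 2`. -/
def sigmaGen (i : ℕ) : Module.End k 𝕋 :=
  DirectSum.toModule k ℕ 𝕋
      (fun n => if i + 2 ≤ n then toTA k V n ∘ₗ sigmaAt σ n i else 0) ∘ₗ
    TensorAlgebra.toDirectSum.toLinearMap

theorem sigmaGen_toTA (i n : ℕ) (a : ⨂[k]^n V) :
    sigmaGen σ i (toTA k V n a) = if i + 2 ≤ n then toTA k V n (sigmaAt σ n i a) else 0 := by
  simp only [sigmaGen, LinearMap.comp_apply, AlgHom.toLinearMap_apply, toDirectSum_toTA,
    DirectSum.toModule_lof]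
  split_ifs <;> rfl

theorem sigmaGen_eq_zero {i n : ℕ} (h : n < i + 2) {x : 𝕋} (hx : x ∈ homog k V n) :
    sigmaGen σ i x = 0 := by
  obtain ⟨a, rfl⟩ := hx
  rw [sigmaGen_toTA, if_neg (by omega)]

theorem sigmaGen_mem {i n : ℕ} {x : 𝕋} (hx : x ∈ homog k V n) : sigmaGen σ i x ∈ homog k V n := by
  obtain ⟨a, rfl⟩ := hx
  rw [sigmaGen_toTA]
  split_ifs
  · exact toTA_mem _ _
  · exact zero_mem _

theorem sigmaGen_mul {i : ℕ} {a : 𝕋} (ha : a ∈ homog k V i) (z : V ⊗[k] V) (b : 𝕋) :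
    sigmaGen σ i (a * ιTwo k V z * b) = a * ιTwo k V (σ z) * b := by
  obtain ⟨a, rfl⟩ := ha
  have := eq_of_homog (f := sigmaGen σ i ∘ₗ LinearMap.mulLeft k (toTA k V i a * ιTwo k V z))
    (g := LinearMap.mulLeft k (toTA k V i a * ιTwo k V (σ z))) (by
      rintro j _ ⟨b, rfl⟩
      simp only [LinearMap.comp_apply, LinearMap.mulLeft_apply]
      rw [← toTA_insertTwo, sigmaGen_toTA, if_pos (by omega), sigmaAt_insertTwo,
        LinearMap.rTensor_tmul, LinearMap.lTensor_tmul, toTA_insertTwo])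
  exact LinearMap.congr_fun this b

variable (k V) in
/-- The product `V ⊗ V ⊗ V → V^{⊗3}` in the tensor algebra. -/
def ιThree : (V ⊗[k] V) ⊗[k] V →ₗ[k] 𝕋 :=
  LinearMap.mul' k 𝕋 ∘ₗ TensorProduct.map (ιTwo k V) (TensorAlgebra.ι k)

theorem sigmaGen_mul_op₁ {i : ℕ} {a : 𝕋} (ha : a ∈ homog k V i) (y : (V ⊗[k] V) ⊗[k] V) (b : 𝕋) :
    sigmaGen σ i (a * ιThree k V y * b) = a * ιThree k V (op₁ σ y) * b := by
  induction y using TensorProduct.induction_on with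
  | zero => simp
  | add y z hy hz => simp only [map_add, mul_add, add_mul, hy, hz]
  | tmul z v =>
    have := sigmaGen_mul σ ha z (TensorAlgebra.ι k v * b)
    simpa [ιThree, op₁, mul_assoc] using this

theorem ιThree_assoc_symm (u : V) (z : V ⊗[k] V) :
    ιThree k V ((TensorProduct.assoc k V V V).symm (u ⊗ₜ z)) =
      TensorAlgebra.ι k u * ιTwo k V z := by
  induction z using TensorProduct.induction_on with
  | zero => simp
  | add y z hy hz => simp only [TensorProduct.tmul_add, map_add, mul_add, hy, hz]
  | tmul v w => simp [ιThree, ιTwo_tmul, mul_assoc]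

theorem sigmaGen_mul_op₂ {i : ℕ} {a : 𝕋} (ha : a ∈ homog k V i) (y : (V ⊗[k] V) ⊗[k] V) (b : 𝕋) :
    sigmaGen σ (i + 1) (a * ιThree k V y * b) = a * ιThree k V (op₂ σ y) * b := by
  obtain ⟨y, rfl⟩ := (TensorProduct.assoc k V V V).symm.surjective y
  induction y using TensorProduct.induction_on with
  | zero => simp
  | add y z hy hz => simp only [map_add, mul_add, add_mul, hy, hz]
  | tmul u z =>
    have := sigmaGen_mul σ (mul_mem_homog ha (ι_mem u)) z b
    simpa [op₂, ιThree_assoc_symm, mul_assoc] using this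

theorem exists_ιThree {x : 𝕋} (hx : x ∈ homog k V 3) : ∃ y, ιThree k V y = x := by
  have h : homog k V (2 + 1) ≤ LinearMap.range (ιThree k V) := by
    refine homog_add_le fun a ha b hb => ?_
    obtain ⟨z, rfl⟩ := exists_ιTwo ha
    obtain ⟨v, rfl⟩ := exists_ι hb
    exact ⟨z ⊗ₜ v, by simp [ιThree]⟩
  exact h hx

theorem eq_of_homog_ιTwo {M : Type*} [AddCommMonoid M] [Module k M] {f g : 𝕋 →ₗ[k] M} {i n : ℕ}
    (hn : i + 2 ≤ n) (h : ∀ a ∈ homog k V i, ∀ z, ∀ b, f (a * ιTwo k V z * b) =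
      g (a * ιTwo k V z * b)) {x : 𝕋} (hx : x ∈ homog k V n) : f x = g x := by
  obtain ⟨j, rfl⟩ := Nat.exists_eq_add_of_le hn
  refine eq_of_homog_mul (fun c hc b _ => ?_) hx
  refine eq_of_homog_mul (f := f ∘ₗ LinearMap.mulRight k b) (g := g ∘ₗ LinearMap.mulRight k b)
    (fun a ha y hy => ?_) hc
  obtain ⟨z, rfl⟩ := exists_ιTwo hy
  exact h a ha z b

/-- No bound on the degree of `x` is required: on components that are too short, both sides vanish
by the convention in `sigmaGen`. -/
theorem sigmaGen_mul_left {m : ℕ} (i : ℕ) {a : 𝕋} (ha : a ∈ homog k V m) (x : 𝕋) :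
    sigmaGen σ (m + i) (a * x) = a * sigmaGen σ i x := by
  refine LinearMap.congr_fun (f := sigmaGen σ (m + i) ∘ₗ LinearMap.mulLeft k a)
    (g := LinearMap.mulLeft k a ∘ₗ sigmaGen σ i) (eq_of_homog fun n x hx => ?_) x
  rcases lt_or_ge n (i + 2) with h | h
  · simp only [LinearMap.comp_apply, LinearMap.mulLeft_apply]
    rw [sigmaGen_eq_zero σ h hx, sigmaGen_eq_zero σ (by omega) (mul_mem_homog ha hx), mul_zero]
  · refine eq_of_homog_ιTwo h (fun c hc z b => ?_) hx
    have := sigmaGen_mul σ (mul_mem_homog ha hc) z b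
    simp only [LinearMap.comp_apply, LinearMap.mulLeft_apply, sigmaGen_mul σ hc]
    simpa only [mul_assoc] using this

theorem sigmaGen_mul_right {m i : ℕ} (h : i + 2 ≤ m) {a : 𝕋} (ha : a ∈ homog k V m) (x : 𝕋) :
    sigmaGen σ i (a * x) = sigmaGen σ i a * x := by
  refine eq_of_homog_ιTwo (f := sigmaGen σ i ∘ₗ LinearMap.mulRight k x)
    (g := LinearMap.mulRight k x ∘ₗ sigmaGen σ i) h (fun c hc z b => ?_) ha
  have := sigmaGen_mul σ hc z (b * x)
  simp only [LinearMap.comp_apply, LinearMap.mulRight_apply, sigmaGen_mul σ hc]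
  simpa only [mul_assoc] using this

theorem sigmaGen_comm {i j : ℕ} (h : i + 2 ≤ j) :
    sigmaGen σ i * sigmaGen σ j = sigmaGen σ j * sigmaGen σ i := by
  refine eq_of_homog fun n x hx => ?_
  rcases lt_or_ge n (i + 2) with hn | hn
  · simp only [Module.End.mul_apply]
    rw [sigmaGen_eq_zero σ hn hx, sigmaGen_eq_zero σ hn (sigmaGen_mem σ hx), map_zero]
  · obtain ⟨d, rfl⟩ := Nat.exists_eq_add_of_le h
    obtain ⟨e, rfl⟩ := Nat.exists_eq_add_of_le hn
    refine eq_of_homog_mul (fun a ha y hy => ?_) hx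
    simp only [Module.End.mul_apply]
    rw [sigmaGen_mul_left σ d ha, sigmaGen_mul_right σ le_rfl ha, sigmaGen_mul_right σ le_rfl ha,
      sigmaGen_mul_left σ d (sigmaGen_mem σ ha)]

/-- In degrees at least `i + 3` this is the hypothesis on three consecutive letters. In lower
degrees both sides contain the vanishing operator `sigmaGen σ (i + 1)`; had it been the identity
there, degree `i + 2` would demand that `σ` be idempotent. -/
theorem sigmaGen_braid {σ : V ⊗[k] V →ₗ[k] V ⊗[k] V} (hσ : IsBraiding σ) (i : ℕ) :
    sigmaGen σ i * sigmaGen σ (i + 1) * sigmaGen σ i =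
      sigmaGen σ (i + 1) * sigmaGen σ i * sigmaGen σ (i + 1) := by
  refine eq_of_homog fun n x hx => ?_
  rcases lt_or_ge n (i + 3) with h | h
  · simp only [Module.End.mul_apply]
    rw [sigmaGen_eq_zero σ (i := i + 1) (by omega) hx, sigmaGen_eq_zero σ (i := i + 1) (by omega)
      (sigmaGen_mem σ hx), map_zero, map_zero]
  · obtain ⟨j, rfl⟩ := Nat.exists_eq_add_of_le h
    refine eq_of_homog_mul (m := i + 3) (n := j) (fun c hc b _ => ?_) hx
    refine eq_of_homog_mul (m := i) (n := 3)
      (f := (sigmaGen σ i * sigmaGen σ (i + 1) * sigmaGen σ i) ∘ₗ LinearMap.mulRight k b)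
      (g := (sigmaGen σ (i + 1) * sigmaGen σ i * sigmaGen σ (i + 1)) ∘ₗ LinearMap.mulRight k b)
      (fun a ha y hy => ?_) hc
    obtain ⟨y, rfl⟩ := exists_ιThree hy
    have := LinearMap.congr_fun hσ y
    simp only [LinearMap.comp_apply] at this
    simp only [LinearMap.comp_apply, LinearMap.mulRight_apply, Module.End.mul_apply,
      sigmaGen_mul_op₁ σ ha, sigmaGen_mul_op₂ σ ha, this]

/-! ### The action of braids, and the block operators `β`. -/

open PosBraid

variable {σ : V ⊗[k] V →ₗ[k] V ⊗[k] V} (hσ : IsBraiding σ)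

/-- The action of the positive braid monoid on the tensor algebra of a braided vector space. -/
def act : PosBraid →* Module.End k 𝕋 :=
  PosBraid.lift (sigmaGen σ) (sigmaGen_braid hσ) fun _ _ => sigmaGen_comm σ

@[simp]
theorem act_gen (i : ℕ) : act hσ (gen i) = sigmaGen σ i := rfl

theorem act_mem (w : PosBraid) {n : ℕ} {x : 𝕋} (hx : x ∈ homog k V n) :
    act hσ w x ∈ homog k V n := by
  induction w using PosBraid.induction with
  | one => simpa using hx
  | gen_mul i w hw => simpa using sigmaGen_mem σ hw

theorem act_shift {m : ℕ} (w : PosBraid) {a : 𝕋} (ha : a ∈ homog k V m) (x : 𝕋) :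
    act hσ (shift m w) (a * x) = a * act hσ w x := by
  induction w using PosBraid.induction with
  | one => simp
  | gen_mul i w hw => simp [hw, sigmaGen_mul_left σ i ha]

/-- The restriction on `w` is essential: a generator beyond the letters of `a` kills `a` but not
necessarily `a * x`. This is why `RepAt` keeps track of strands. -/
theorem act_strands {m : ℕ} {w : PosBraid} (hw : w ∈ strands m) {a : 𝕋} (ha : a ∈ homog k V m)
    (x : 𝕋) : act hσ w (a * x) = act hσ w a * x := by
  induction hw using Submonoid.closure_induction generalizing a with
  | mem w hw =>
    obtain ⟨i, hi, rfl⟩ := hw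
    exact sigmaGen_mul_right σ hi ha x
  | one => simp
  | mul u v _ _ hu hv =>
    simp only [map_mul, Module.End.mul_apply]
    rw [hv ha, hu (act_mem hσ v ha)]

theorem prod_range_gen (n : ℕ) : (((List.range n).map gen).reverse).prod = cyc n := by
  induction n with
  | zero => rfl
  | succ n ih => simp [List.range_succ, ih, cyc]

theorem prod_blockWord (m n : ℕ) : ((blockWord m n).map gen).prod = blk m n := by
  induction m with
  | zero => rfl
  | succ m ih =>
    have h : (blockWord (m + 1) n).map gen =
        ((List.range n).map gen).reverse ++ ((blockWord m n).map gen).map (shift 1) := by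
      simp only [blockWord, List.range_succ_eq_map, List.flatMap_cons, List.flatMap_map,
        List.map_append, List.map_flatMap, List.map_reverse, List.map_map]
      congr 2
      · simp
      · funext r
        congr 2
        funext s
        simp only [Function.comp_apply, shift_gen]
        congr 1
        omega
    rw [h, List.prod_append, prod_range_gen, ← map_list_prod, ih, blk]

theorem lt_of_mem_blockWord {m n i : ℕ} (h : i ∈ blockWord m n) : i + 2 ≤ m + n := by
  simp only [blockWord, List.mem_flatMap, List.mem_range, List.mem_reverse, List.mem_map] at h
  obtain ⟨r, hr, s, hs, rfl⟩ := h
  omega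

/-- Every letter of `blockWord m n` fits into degree `m + n`, so `sigmaAt` and `sigmaGen` agree
along the whole word. -/
theorem toTA_betaEnd (m n : ℕ) (x : ⨂[k]^(m + n) V) :
    toTA k V (m + n) (betaEnd σ m n x) = act hσ (blk m n) (toTA k V (m + n) x) := by
  rw [← prod_blockWord, betaEnd]
  have h : ∀ i ∈ blockWord m n, i + 2 ≤ m + n := fun i => lt_of_mem_blockWord
  revert h
  induction blockWord m n with
  | nil => simp
  | cons i l ih =>
    intro h
    simp only [List.map_cons, List.prod_cons, map_mul, Module.End.mul_apply, act_gen]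
    rw [← ih fun j hj => h j (List.mem_cons_of_mem _ hj), sigmaGen_toTA,
      if_pos (h i List.mem_cons_self)]

theorem mul_toTA_beta {m n : ℕ} (a : ⨂[k]^m V) (b : ⨂[k]^n V) :
    LinearMap.mul' k 𝕋 (TensorProduct.map (toTA k V n) (toTA k V m) (beta σ m n (a ⊗ₜ b))) =
      act hσ (blk m n) (toTA k V m a * toTA k V n b) := by
  have h : LinearMap.mul' k 𝕋 ∘ₗ TensorProduct.map (toTA k V n) (toTA k V m) =
      toTA k V (n + m) ∘ₗ TensorPower.mulEquiv.toLinearMap := by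
    refine TensorProduct.ext' fun a b => ?_
    simp [toTA_mulEquiv]
  have := LinearMap.congr_fun h (beta σ m n (a ⊗ₜ b))
  simp only [LinearMap.comp_apply] at this
  rw [this, beta]
  simp only [LinearMap.comp_apply, LinearEquiv.coe_coe, LinearEquiv.apply_symm_apply, toTA_cast]
  rw [toTA_betaEnd hσ, toTA_mulEquiv]

end TensorAction

/-! ### Linear maps given by sums of braids -/

section Frames

open Multiset PosBraid

variable {k : Type*} [CommSemiring k] {V : Type*} [AddCommMonoid V] [Module k V]

local notation "𝕋" => TensorAlgebra k V

/-- A family of maps from the tensor algebra to `A`, indexed by `I`, such that `A` is spanned by the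
images of the homogeneous elements of certain degrees. -/
structure Frame (k : Type*) [CommSemiring k] (V : Type*) [AddCommMonoid V] [Module k V]
    (A : Type*) [AddCommMonoid A] [Module k A] (I : Type) where
  deg : I → ℕ
  elt : I → TensorAlgebra k V →ₗ[k] A
  span_eq_top : Submodule.span k {a | ∃ i, ∃ x ∈ homog k V (deg i), elt i x = a} = ⊤

variable {A B C A' B' C' M : Type*} [AddCommMonoid A] [Module k A] [AddCommMonoid B] [Module k B]
  [AddCommMonoid C] [Module k C] [AddCommMonoid A'] [Module k A'] [AddCommMonoid B'] [Module k B']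
  [AddCommMonoid C'] [Module k C']
  [AddCommMonoid M] [Module k M] {I J L I' J' L' : Type}

theorem Frame.hom_ext (F : Frame k V A I) {f g : A →ₗ[k] M}
    (h : ∀ i, ∀ x ∈ homog k V (F.deg i), f (F.elt i x) = g (F.elt i x)) : f = g := by
  refine LinearMap.ext_on F.span_eq_top ?_
  rintro _ ⟨i, x, hx, rfl⟩
  exact h i x hx

variable (k V) in
/-- Splitting a homogeneous element of degree `m + n`. -/
def split (m n : ℕ) : 𝕋 →ₗ[k] 𝕋 ⊗[k] 𝕋 :=
  TensorProduct.map (toTA k V m) (toTA k V n) ∘ₗ TensorPower.mulEquiv.symm.toLinearMap ∘ₗ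
    homogComponent k V (m + n)

theorem split_mul {m n : ℕ} {a b : 𝕋} (ha : a ∈ homog k V m) (hb : b ∈ homog k V n) :
    split k V m n (a * b) = a ⊗ₜ b := by
  obtain ⟨a, rfl⟩ := ha
  obtain ⟨b, rfl⟩ := hb
  simp [split, ← toTA_mulEquiv]

/-- The tensor product of two frames. -/
def Frame.tensor (F : Frame k V A I) (G : Frame k V B J) : Frame k V (A ⊗[k] B) (I × J) where
  deg i := F.deg i.1 + G.deg i.2
  elt i := TensorProduct.map (F.elt i.1) (G.elt i.2) ∘ₗ split k V (F.deg i.1) (G.deg i.2)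
  span_eq_top := by
    rw [eq_top_iff, ← TensorProduct.map₂_mk_top_top_eq_top, ← F.span_eq_top, ← G.span_eq_top,
      Submodule.map₂_span_span, Submodule.span_le]
    rintro _ ⟨_, ⟨i, x, hx, rfl⟩, _, ⟨j, y, hy, rfl⟩, rfl⟩
    exact Submodule.subset_span ⟨(i, j), x * y, mul_mem_homog hx hy, by simp [split_mul hx hy]⟩

@[simp]
theorem Frame.tensor_deg (F : Frame k V A I) (G : Frame k V B J) (i : I × J) :
    (F.tensor G).deg i = F.deg i.1 + G.deg i.2 := rfl

theorem Frame.tensor_elt (F : Frame k V A I) (G : Frame k V B J) {i : I × J} {a b : 𝕋}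
    (ha : a ∈ homog k V (F.deg i.1)) (hb : b ∈ homog k V (G.deg i.2)) :
    (F.tensor G).elt i (a * b) = F.elt i.1 a ⊗ₜ G.elt i.2 b := by
  simp [Frame.tensor, split_mul ha hb]

variable {σ : V ⊗[k] V →ₗ[k] V ⊗[k] V} (hσ : IsBraiding σ)

/-- The sum of the elements obtained from a homogeneous element by applying braids. -/
def Frame.ev (F : Frame k V A I) (S : Multiset (I × PosBraid)) : 𝕋 →ₗ[k] A :=
  (S.map fun p => F.elt p.1 ∘ₗ act hσ p.2).sum

variable (F : Frame k V A I) (G : Frame k V B J) (H : Frame k V C L)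
variable (F' : Frame k V A' I') (G' : Frame k V B' J') (H' : Frame k V C' L')

@[simp]
theorem Frame.ev_zero : F.ev hσ 0 = 0 := by simp [Frame.ev]

@[simp]
theorem Frame.ev_add (S T : Multiset (I × PosBraid)) : F.ev hσ (S + T) = F.ev hσ S + F.ev hσ T := by
  simp [Frame.ev]

@[simp]
theorem Frame.ev_singleton (p : I × PosBraid) : F.ev hσ {p} = F.elt p.1 ∘ₗ act hσ p.2 := by
  simp [Frame.ev]

/-- On the component `i`, the map `f` is given by the sum of braids `S`. -/
structure RepAt (f : A →ₗ[k] B) (i : I) (S : Multiset (J × PosBraid)) : Prop where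
  deg_eq : ∀ p ∈ S, G.deg p.1 = F.deg i
  mem_strands : ∀ p ∈ S, p.2 ∈ strands (F.deg i)
  apply_elt : ∀ x ∈ homog k V (F.deg i), f (F.elt i x) = G.ev hσ S x

variable {F G H F' G' H'} {hσ}

theorem RepAt.congr {f : A →ₗ[k] B} {i : I} {S T : Multiset (J × PosBraid)}
    (h : RepAt hσ F G f i S) (e : S = T) : RepAt hσ F G f i T := e ▸ h

theorem eq_of_repAt {f g : A →ₗ[k] B} {K : I → Multiset (J × PosBraid)}
    (hf : ∀ i, RepAt hσ F G f i (K i)) (hg : ∀ i, RepAt hσ F G g i (K i)) : f = g :=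
  F.hom_ext fun i x hx => by rw [(hf i).apply_elt x hx, (hg i).apply_elt x hx]

/-- The bridge from linear algebra to combinatorics. A representing multiset need not be unique, so
only this direction is available, and it is enough. -/
theorem eq_of_repAt_of_eq {f g : A →ₗ[k] B} {K K' : I → Multiset (J × PosBraid)}
    (hf : ∀ i, RepAt hσ F G f i (K i)) (hg : ∀ i, RepAt hσ F G g i (K' i))
    (h : ∀ i, K i = K' i) : f = g :=
  eq_of_repAt hf fun i => (hg i).congr (h i).symm

theorem RepAt.id (i : I) : RepAt hσ F F LinearMap.id i {(i, 1)} where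
  deg_eq := by simp
  mem_strands := by simp
  apply_elt x _ := by simp

theorem RepAt.comp {f : A →ₗ[k] B} {g : B →ₗ[k] C} {i : I} {S : Multiset (J × PosBraid)}
    {K : J → Multiset (L × PosBraid)} (hg : ∀ j, RepAt hσ G H g j (K j))
    (hf : RepAt hσ F G f i S) :
    RepAt hσ F H (g ∘ₗ f) i (S.bind fun p => (K p.1).map fun q => (q.1, q.2 * p.2)) where
  deg_eq q hq := by
    simp only [mem_bind, mem_map] at hq
    obtain ⟨p, hp, q, hq, rfl⟩ := hq
    exact ((hg p.1).deg_eq q hq).trans (hf.deg_eq p hp)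
  mem_strands q hq := by
    simp only [mem_bind, mem_map] at hq
    obtain ⟨p, hp, q, hq, rfl⟩ := hq
    exact mul_mem (hf.deg_eq p hp ▸ (hg p.1).mem_strands q hq) (hf.mem_strands p hp)
  apply_elt x hx := by
    have hd := hf.deg_eq
    rw [LinearMap.comp_apply, hf.apply_elt x hx]
    -- A sub-multiset no longer represents `f`, but `f` has just been eliminated; the induction
    -- needs only the degree condition.
    clear hf
    induction S using Multiset.induction_on with
    | empty => simp
    | cons p S ih =>
      have e : H.ev hσ ((K p.1).map fun q => (q.1, q.2 * p.2)) = H.ev hσ (K p.1) ∘ₗ act hσ p.2 := by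
        induction K p.1 using Multiset.induction_on with
        | empty => simp
        | cons q T ih =>
          rw [map_cons, ← singleton_add, ← singleton_add, Frame.ev_add, ih, Frame.ev_add,
            LinearMap.add_comp, Frame.ev_singleton, Frame.ev_singleton, map_mul]
          rfl
      have hx' : act hσ p.2 x ∈ homog k V (G.deg p.1) := by
        rw [hd p (mem_cons_self _ _)]
        exact act_mem hσ _ hx
      rw [← singleton_add, add_bind, singleton_bind, Frame.ev_add, Frame.ev_add,
        LinearMap.add_apply, LinearMap.add_apply, _root_.map_add,
        ih fun q hq => hd q (mem_cons_of_mem hq), e, LinearMap.comp_apply,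
        ← (hg p.1).apply_elt _ hx', Frame.ev_singleton, LinearMap.comp_apply]

theorem RepAt.map {f : A →ₗ[k] A'} {g : B →ₗ[k] B'} {i : I} {j : J}
    {S : Multiset (I' × PosBraid)} {T : Multiset (J' × PosBraid)}
    (hf : RepAt hσ F F' f i S) (hg : RepAt hσ G G' g j T) :
    RepAt hσ (F.tensor G) (F'.tensor G') (TensorProduct.map f g) (i, j)
      (S.bind fun p => T.map fun q => ((p.1, q.1), p.2 * shift (F.deg i) q.2)) where
  deg_eq q hq := by
    simp only [mem_bind, mem_map] at hq
    obtain ⟨p, hp, q, hq, rfl⟩ := hq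
    simp [hf.deg_eq p hp, hg.deg_eq q hq]
  mem_strands q hq := by
    simp only [mem_bind, mem_map] at hq
    obtain ⟨p, hp, q, hq, rfl⟩ := hq
    exact mul_mem (strands_mono (Nat.le_add_right _ _) (hf.mem_strands p hp))
      (shift_mem_strands (hg.mem_strands q hq) le_rfl)
  apply_elt x hx := by
    refine eq_of_homog_mul (f := TensorProduct.map f g ∘ₗ (F.tensor G).elt (i, j))
      (fun a ha b hb => ?_) hx
    rw [LinearMap.comp_apply, Frame.tensor_elt F G ha hb, TensorProduct.map_tmul,
      hf.apply_elt a ha, hg.apply_elt b hb]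
    have hS := hf.deg_eq
    have hS' := hf.mem_strands
    have hT := hg.deg_eq
    clear hf hg
    induction S using Multiset.induction_on with
    | empty => simp
    | cons p S ih =>
      have e : (F'.tensor G').ev hσ (T.map fun q => ((p.1, q.1), p.2 * shift (F.deg i) q.2))
          (a * b) = F'.elt p.1 (act hσ p.2 a) ⊗ₜ G'.ev hσ T b := by
        clear ih
        induction T using Multiset.induction_on with
        | empty => simp
        | cons q T ih =>
          have ha' : act hσ p.2 a ∈ homog k V (F'.deg p.1) := by
            rw [hS p (mem_cons_self _ _)]
            exact act_mem hσ _ ha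
          have hb' : act hσ q.2 b ∈ homog k V (G'.deg q.1) := by
            rw [hT q (mem_cons_self _ _)]
            exact act_mem hσ _ hb
          -- The shifted braid acts first and leaves `a` untouched; then `p.2`, confined to the
          -- strands of `a`, acts on `a` alone.
          rw [map_cons, ← singleton_add, ← singleton_add, Frame.ev_add, LinearMap.add_apply,
            ih fun q hq => hT q (mem_cons_of_mem hq), Frame.ev_add, LinearMap.add_apply,
            TensorProduct.tmul_add, Frame.ev_singleton, Frame.ev_singleton, LinearMap.comp_apply,
            LinearMap.comp_apply, map_mul (act hσ), Module.End.mul_apply, act_shift hσ _ ha,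
            act_strands hσ (hS' p (mem_cons_self _ _)) ha]
          exact congrArg (· + _) (F'.tensor_elt G' (i := (p.1, q.1)) ha' hb')
      rw [← singleton_add, add_bind, singleton_bind, Frame.ev_add, Frame.ev_add,
        LinearMap.add_apply, LinearMap.add_apply, TensorProduct.add_tmul,
        ih (fun q hq => hS q (mem_cons_of_mem hq)) (fun q hq => hS' q (mem_cons_of_mem hq)), e,
        Frame.ev_singleton, LinearMap.comp_apply]

theorem RepAt.rTensor {f : A →ₗ[k] A'} {i : I} {S : Multiset (I' × PosBraid)}
    (hf : RepAt hσ F F' f i S) (j : J) :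
    RepAt hσ (F.tensor G) (F'.tensor G) (f.rTensor B) (i, j)
      (S.map fun p => ((p.1, j), p.2)) :=
  (hf.map (RepAt.id j)).congr (by simp [bind_singleton])

theorem RepAt.lTensor {g : B →ₗ[k] B'} {j : J} {T : Multiset (J' × PosBraid)} (i : I)
    (hg : RepAt hσ G G' g j T) :
    RepAt hσ (F.tensor G) (F.tensor G') (g.lTensor A) (i, j)
      (T.map fun q => ((i, q.1), shift (F.deg i) q.2)) :=
  ((RepAt.id i).map hg).congr (by simp)

theorem Frame.assoc_elt {i : I} {j : J} {l : L} {a b c : 𝕋} (ha : a ∈ homog k V (F.deg i))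
    (hb : b ∈ homog k V (G.deg j)) (hc : c ∈ homog k V (H.deg l)) :
    TensorProduct.assoc k A B C (((F.tensor G).tensor H).elt ((i, j), l) (a * b * c)) =
      (F.tensor (G.tensor H)).elt (i, (j, l)) (a * b * c) := by
  have h₁ := Frame.tensor_elt (i := ((i, j), l)) (F.tensor G) H (mul_mem_homog ha hb) hc
  have h₂ := Frame.tensor_elt (i := (i, j)) F G ha hb
  have h₃ := Frame.tensor_elt (i := (i, (j, l))) F (G.tensor H) ha (mul_mem_homog hb hc)
  have h₄ := Frame.tensor_elt (i := (j, l)) G H hb hc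
  rw [h₁, h₂, mul_assoc, h₃, h₄, TensorProduct.assoc_tmul]

theorem RepAt.assoc (i : (I × J) × L) :
    RepAt hσ ((F.tensor G).tensor H) (F.tensor (G.tensor H))
      (TensorProduct.assoc k A B C).toLinearMap i {((i.1.1, (i.1.2, i.2)), 1)} where
  deg_eq := by simp [add_assoc]
  mem_strands := by simp
  apply_elt x hx := by
    obtain ⟨⟨i, j⟩, l⟩ := i
    rw [Frame.ev_singleton, map_one]
    let f := (TensorProduct.assoc k A B C).toLinearMap ∘ₗ
      ((F.tensor G).tensor H).elt ((i, j), l)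
    let g := (F.tensor (G.tensor H)).elt (i, (j, l))
    change f x = g x
    refine eq_of_homog_mul (m := F.deg i + G.deg j) (n := H.deg l) (fun y hy c hc => ?_) hx
    exact eq_of_homog_mul (f := f ∘ₗ LinearMap.mulRight k c) (g := g ∘ₗ LinearMap.mulRight k c)
      (fun a ha b hb => Frame.assoc_elt ha hb hc) hy

theorem RepAt.assoc_symm (i : I × (J × L)) :
    RepAt hσ (F.tensor (G.tensor H)) ((F.tensor G).tensor H)
      (TensorProduct.assoc k A B C).symm.toLinearMap i {(((i.1, i.2.1), i.2.2), 1)} where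
  deg_eq := by simp [add_assoc]
  mem_strands := by simp
  apply_elt x hx := by
    have h := RepAt.assoc (hσ := hσ) (F := F) (G := G) (H := H) ((i.1, i.2.1), i.2.2)
    have hx' : x ∈ homog k V (((F.tensor G).tensor H).deg ((i.1, i.2.1), i.2.2)) := by
      rw [h.deg_eq _ (mem_singleton_self _)] at *
      exact hx
    have := h.apply_elt x hx'
    simp only [Frame.ev_singleton, map_one, LinearMap.comp_apply, Module.End.one_apply,
      LinearEquiv.coe_coe] at this ⊢
    rw [← this, LinearEquiv.symm_apply_apply]

theorem RepAt.op₁ {f : A ⊗[k] A →ₗ[k] A ⊗[k] A} {K : I × I → Multiset ((I × I) × PosBraid)}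
    (hf : ∀ i, RepAt hσ (F.tensor F) (F.tensor F) f i (K i)) (i : (I × I) × I) :
    RepAt hσ ((F.tensor F).tensor F) ((F.tensor F).tensor F) (op₁ f) i
      ((K i.1).map fun p => ((p.1, i.2), p.2)) :=
  (hf i.1).rTensor i.2

theorem RepAt.op₂ {f : A ⊗[k] A →ₗ[k] A ⊗[k] A} {K : I × I → Multiset ((I × I) × PosBraid)}
    (hf : ∀ i, RepAt hσ (F.tensor F) (F.tensor F) f i (K i)) (i : (I × I) × I) :
    RepAt hσ ((F.tensor F).tensor F) ((F.tensor F).tensor F) (op₂ f) i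
      ((K (i.1.2, i.2)).map fun p => (((i.1.1, p.1.1), p.1.2), shift (F.deg i.1.1) p.2)) :=
  (RepAt.comp RepAt.assoc_symm
    (RepAt.comp (fun j : I × (I × I) => RepAt.lTensor j.1 (hf j.2)) (RepAt.assoc i))).congr
      (by simp [bind_singleton])

end Frames

/-! ### The structure maps of the space of decorated trees as sums of braids -/

section StructureMaps

open Multiset PosBraid

variable {k : Type*} [CommSemiring k] {V : Type*} [AddCommMonoid V] [Module k V]

local notation "𝕋" => TensorAlgebra k V

variable {A B C D B' C' : Type*} [AddCommMonoid A] [Module k A] [AddCommMonoid B] [Module k B]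
  [AddCommMonoid C] [Module k C] [AddCommMonoid D] [Module k D] [AddCommMonoid B'] [Module k B']
  [AddCommMonoid C'] [Module k C'] {I J L N J' L' : Type}
  {F : Frame k V A I} {G : Frame k V B J} {H : Frame k V C L} {E : Frame k V D N}
  {G' : Frame k V B' J'} {H' : Frame k V C' L'}
  {σ : V ⊗[k] V →ₗ[k] V ⊗[k] V} {hσ : IsBraiding σ}

theorem RepAt.opMid {f : B ⊗[k] C →ₗ[k] C' ⊗[k] B'} {K : J × L → Multiset ((L' × J') × PosBraid)}
    (hf : ∀ i, RepAt hσ (G.tensor H) (H'.tensor G') f i (K i)) (i : (I × J) × (L × N)) :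
    RepAt hσ ((F.tensor G).tensor (H.tensor E)) ((F.tensor H').tensor (G'.tensor E)) (opMid f) i
      ((K (i.1.2, i.2.1)).map fun p =>
        (((i.1.1, p.1.1), (p.1.2, i.2.2)), shift (F.deg i.1.1) p.2)) := by
  have h₁ (j : J × (L × N)) := RepAt.comp RepAt.assoc
    (RepAt.comp (fun j : (J × L) × N => (hf j.1).rTensor (G := E) j.2)
      (RepAt.assoc_symm (hσ := hσ) (F := G) (G := H) (H := E) j))
  refine (RepAt.comp RepAt.assoc_symm
    (RepAt.comp (fun j : I × (J × (L × N)) => RepAt.lTensor j.1 (h₁ j.2))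
      (RepAt.assoc (hσ := hσ) (F := F) (G := G) (H := H.tensor E) i))).congr ?_
  simp [bind_singleton]

/-! ### Frames for scalars, decorations and trees. -/

variable (k V) in
/-- The frame of the ground ring. -/
def scalarFrame : Frame k V k Unit where
  deg _ := 0
  elt _ := TensorPower.algebraMap₀.symm.toLinearMap ∘ₗ homogComponent k V 0
  span_eq_top := by
    rw [eq_top_iff]
    intro c _
    exact Submodule.subset_span ⟨(), _, toTA_mem 0 (TensorPower.algebraMap₀ c), by simp⟩

variable (k V) in
/-- The frame of the space of decorations. -/
def vecFrame : Frame k V V Unit where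
  deg _ := 1
  elt _ := (oneEquiv k V).symm.toLinearMap ∘ₗ homogComponent k V 1
  span_eq_top := by
    rw [eq_top_iff]
    intro v _
    exact Submodule.subset_span ⟨(), _, toTA_mem 1 (oneEquiv k V v), by simp⟩

variable (k V) in
/-- The frame of the space of decorated trees. -/
def treeFrame : Frame k V (TreeSpace k V) PBT where
  deg := BinaryTree.numNodes
  elt t := ofTree t ∘ₗ homogComponent k V t.numNodes
  span_eq_top := by
    rw [eq_top_iff]
    intro x _
    induction x using treeSpace_induction with
    | h_of t a => exact Submodule.subset_span ⟨t, _, toTA_mem _ a, by simp⟩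
    | h_add x y hx hy => exact add_mem (hx trivial) (hy trivial)

@[simp]
theorem treeFrame_deg (t : PBT) : (treeFrame k V).deg t = t.numNodes := rfl

@[simp]
theorem scalarFrame_deg (u : Unit) : (scalarFrame k V).deg u = 0 := rfl

@[simp]
theorem vecFrame_deg (u : Unit) : (vecFrame k V).deg u = 1 := rfl

theorem treeFrame_elt_toTA (t : PBT) (a : ⨂[k]^t.numNodes V) :
    (treeFrame k V).elt t (toTA k V _ a) = ofTree t a := by
  simp [treeFrame]

theorem vecFrame_elt_ι (u : Unit) (v : V) : (vecFrame k V).elt u (TensorAlgebra.ι k v) = v := by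
  simp [vecFrame, ← toTA_oneEquiv]

theorem scalarFrame_elt_algebraMap (u : Unit) (c : k) :
    (scalarFrame k V).elt u (algebraMap k 𝕋 c) = c := by
  simp [scalarFrame, ← toTA_algebraMap₀]

theorem treeFrame_elt_algebraMap (c : k) :
    (treeFrame k V).elt .nil (algebraMap k 𝕋 c) = c • leaf := by
  rw [← toTA_algebraMap₀]
  refine (treeFrame_elt_toTA (k := k) (V := V) .nil (TensorPower.algebraMap₀ c)).trans ?_
  rw [leaf, ← map_smul, ← map_smul, smul_eq_mul, mul_one]
  rfl

theorem treeFrame_elt_one : (treeFrame k V).elt .nil 1 = leaf := by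
  rw [← map_one (algebraMap k 𝕋), treeFrame_elt_algebraMap, one_smul]

theorem exists_algebraMap {x : 𝕋} (hx : x ∈ homog k V 0) : ∃ c, algebraMap k 𝕋 c = x := by
  obtain ⟨a, rfl⟩ := hx
  exact ⟨TensorPower.algebraMap₀.symm a, by rw [← toTA_algebraMap₀]; simp⟩

theorem RepAt.lid (i : Unit × I) :
    RepAt hσ ((scalarFrame k V).tensor F) F (TensorProduct.lid k A).toLinearMap i {(i.2, 1)} where
  deg_eq := by simp
  mem_strands := by simp
  apply_elt x hx := by
    refine eq_of_homog_mul (m := 0) (n := F.deg i.2) (f := (TensorProduct.lid k A).toLinearMap ∘ₗ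
      ((scalarFrame k V).tensor F).elt i) (fun a ha b hb => ?_) hx
    rw [LinearMap.comp_apply, Frame.tensor_elt _ _ ha hb]
    obtain ⟨c, rfl⟩ := exists_algebraMap ha
    simp [scalarFrame_elt_algebraMap, ← Algebra.smul_def]

theorem RepAt.rid (i : I × Unit) :
    RepAt hσ (F.tensor (scalarFrame k V)) F (TensorProduct.rid k A).toLinearMap i {(i.1, 1)} where
  deg_eq := by simp
  mem_strands := by simp
  apply_elt x hx := by
    refine eq_of_homog_mul (m := F.deg i.1) (n := 0) (f := (TensorProduct.rid k A).toLinearMap ∘ₗ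
      (F.tensor (scalarFrame k V)).elt i) (fun a ha b hb => ?_) hx
    rw [LinearMap.comp_apply, Frame.tensor_elt _ _ ha hb]
    obtain ⟨c, rfl⟩ := exists_algebraMap hb
    simp [scalarFrame_elt_algebraMap, ← Algebra.commutes, ← Algebra.smul_def]

theorem graft_elt {l r : PBT} {a b : 𝕋} (ha : a ∈ homog k V l.numNodes) (v : V)
    (hb : b ∈ homog k V r.numNodes) :
    graft ((treeFrame k V).elt l a ⊗ₜ (v ⊗ₜ (treeFrame k V).elt r b)) =
      (treeFrame k V).elt (.node () l r) (a * (TensorAlgebra.ι k v * b)) := by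
  obtain ⟨a, rfl⟩ := ha
  obtain ⟨b, rfl⟩ := hb
  rw [treeFrame_elt_toTA, treeFrame_elt_toTA, graft_ofTree, ← treeFrame_elt_toTA]
  congr 1
  simp only [decor, LinearEquiv.trans_apply, TensorProduct.congr_tmul, LinearEquiv.refl_apply]
  erw [toTA_cast]
  rw [toTA_mulEquiv, toTA_mulEquiv, toTA_oneEquiv]

theorem RepAt.graft (i : PBT × (Unit × PBT)) :
    RepAt hσ ((treeFrame k V).tensor ((vecFrame k V).tensor (treeFrame k V))) (treeFrame k V)
      graft i {(.node () i.1 i.2.2, 1)} where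
  deg_eq := by simp; omega
  mem_strands := by simp
  apply_elt x hx := by
    obtain ⟨l, u, r⟩ := i
    rw [Frame.ev_singleton, map_one]
    let f := BraidedTree.graft ∘ₗ
      ((treeFrame k V).tensor ((vecFrame k V).tensor (treeFrame k V))).elt (l, (u, r))
    let g := (treeFrame k V).elt (.node () l r)
    change f x = g x
    refine eq_of_homog_mul (m := l.numNodes) (n := 1 + r.numNodes) (fun a ha y hy => ?_) hx
    refine eq_of_homog_mul (f := f ∘ₗ LinearMap.mulLeft k a) (g := g ∘ₗ LinearMap.mulLeft k a)
      (fun c hc b hb => ?_) hy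
    have h₁ := Frame.tensor_elt (i := (l, (u, r))) (treeFrame k V)
      ((vecFrame k V).tensor (treeFrame k V)) ha (mul_mem_homog hc hb)
    have h₂ := Frame.tensor_elt (i := (u, r)) (vecFrame k V) (treeFrame k V) hc hb
    obtain ⟨v, rfl⟩ := exists_ι hc
    simp only [LinearMap.comp_apply, LinearMap.mulLeft_apply, f, g]
    rw [h₁, h₂, vecFrame_elt_ι, graft_elt ha v hb]

/-- Homogeneous elements of the degree of a grafted tree are sums of products. -/
theorem eq_of_homog_node {M : Type*} [AddCommMonoid M] [Module k M] {f g : 𝕋 →ₗ[k] M} {l r : PBT}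
    (h : ∀ a ∈ homog k V l.numNodes, ∀ v, ∀ b ∈ homog k V r.numNodes,
      f (a * (TensorAlgebra.ι k v * b)) = g (a * (TensorAlgebra.ι k v * b))) {x : 𝕋}
    (hx : x ∈ homog k V (BinaryTree.node () l r).numNodes) : f x = g x := by
  rw [numNodes_node, add_assoc, add_comm r.numNodes] at hx
  refine eq_of_homog_mul (fun a ha y hy => ?_) hx
  refine eq_of_homog_mul (f := f ∘ₗ LinearMap.mulLeft k a) (g := g ∘ₗ LinearMap.mulLeft k a)
    (fun c hc b hb => ?_) hy
  obtain ⟨v, rfl⟩ := exists_ι hc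
  exact h a ha v b hb

theorem node_mem_homog {l r : PBT} {a b : 𝕋} (ha : a ∈ homog k V l.numNodes) (v : V)
    (hb : b ∈ homog k V r.numNodes) :
    a * (TensorAlgebra.ι k v * b) ∈ homog k V (BinaryTree.node () l r).numNodes := by
  rw [numNodes_node, add_assoc, add_comm r.numNodes]
  exact mul_mem_homog ha (mul_mem_homog (ι_mem v) hb)

/-- All trees of a product share the same word of decorations, which is why a single `b` serves the
whole multiset. -/
theorem graft_sum_right {l : PBT} {n : ℕ} {a b : 𝕋} (ha : a ∈ homog k V l.numNodes) (v : V)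
    (hb : b ∈ homog k V n) {S : Multiset PBT} (hS : ∀ u ∈ S, u.numNodes = n) :
    graft ((treeFrame k V).elt l a ⊗ₜ (v ⊗ₜ (S.map fun u => (treeFrame k V).elt u b).sum)) =
      (S.map fun u => (treeFrame k V).elt (.node () l u) (a * (TensorAlgebra.ι k v * b))).sum := by
  induction S using Multiset.induction_on with
  | empty => simp
  | cons u S ih =>
    simp only [map_cons, sum_cons, TensorProduct.tmul_add, _root_.map_add]
    rw [ih fun w hw => hS w (mem_cons_of_mem hw),
      graft_elt ha v ((hS u (mem_cons_self _ _)).symm ▸ hb)]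

theorem graft_sum_left {r : PBT} {n : ℕ} {a b : 𝕋} (ha : a ∈ homog k V n) (v : V)
    (hb : b ∈ homog k V r.numNodes) {S : Multiset PBT} (hS : ∀ u ∈ S, u.numNodes = n) :
    graft ((S.map fun u => (treeFrame k V).elt u a).sum ⊗ₜ (v ⊗ₜ (treeFrame k V).elt r b)) =
      (S.map fun u => (treeFrame k V).elt (.node () u r) (a * (TensorAlgebra.ι k v * b))).sum := by
  induction S using Multiset.induction_on with
  | empty => simp
  | cons u S ih =>
    simp only [map_cons, sum_cons, TensorProduct.add_tmul, _root_.map_add]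
    rw [ih fun w hw => hS w (mem_cons_of_mem hw),
      graft_elt ((hS u (mem_cons_self _ _)).symm ▸ ha) v hb]

/-- The product concatenates the decorations in their given order, because in-order reading of both
summands of the recursion yields the first word followed by the second. -/
theorem mul_elt {s t : PBT} {a b : 𝕋} (ha : a ∈ homog k V s.numNodes)
    (hb : b ∈ homog k V t.numNodes) :
    mul ((treeFrame k V).elt s a ⊗ₜ (treeFrame k V).elt t b) =
      ((mulTrees s t).map fun u => (treeFrame k V).elt u (a * b)).sum := by
  induction s, t using mulTrees.induct generalizing a b with
  | case1 t =>
    obtain ⟨c, rfl⟩ := exists_algebraMap ha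
    rw [treeFrame_elt_algebraMap, ← TensorProduct.smul_tmul', map_smul, leaf_mul]
    simp [← Algebra.smul_def]
  | case2 u l r =>
    obtain ⟨c, rfl⟩ := exists_algebraMap hb
    rw [treeFrame_elt_algebraMap, TensorProduct.tmul_smul, map_smul, mul_leaf]
    simp [← Algebra.commutes, ← Algebra.smul_def]
  | case3 u l r u' l' r' ih₁ ih₂ =>
    obtain rfl : u = () := rfl
    obtain rfl : u' = () := rfl
    -- Both sides are turned into bilinear maps, so that each word can be decomposed separately into
    -- left branch, root and right branch.
    let T := treeFrame k V
    let f : 𝕋 →ₗ[k] 𝕋 →ₗ[k] TreeSpace k V :=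
      (TensorProduct.mk k _ _).compr₂ (BraidedTree.mul (k := k) (V := V)) |>.compl₁₂
        (T.elt (.node () l r)) (T.elt (.node () l' r'))
    let g : 𝕋 →ₗ[k] 𝕋 →ₗ[k] TreeSpace k V :=
      (LinearMap.mul k 𝕋).compr₂
        (((mulTrees (.node () l r) (.node () l' r')).map fun u => T.elt u).sum)
    have hg (x y : 𝕋) : g x y = ((mulTrees (.node () l r) (.node () l' r')).map
        fun u => T.elt u (x * y)).sum := by
      change ((mulTrees (.node () l r) (.node () l' r')).map fun u => T.elt u).sum (x * y) = _
      rw [← LinearMap.applyₗ_apply_apply (x * y), map_multiset_sum, map_map]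
      rfl
    rw [← hg]
    change f a b = g a b
    refine eq_of_homog_node (f := f.flip b) (g := g.flip b) (fun a₁ ha₁ v a₂ ha₂ => ?_) ha
    refine eq_of_homog_node (f := f (a₁ * (TensorAlgebra.ι k v * a₂)))
      (g := g (a₁ * (TensorAlgebra.ι k v * a₂))) (fun b₁ hb₁ w b₂ hb₂ => ?_) hb
    rw [hg]
    change BraidedTree.mul (T.elt _ _ ⊗ₜ T.elt _ _) = _
    have h₁ := graft_elt ha₁ v ha₂
    have h₂ := graft_elt hb₁ w hb₂
    rw [← h₁, ← h₂, mul_graft_graft, h₁, h₂, ih₁ ha₂ (node_mem_homog hb₁ w hb₂),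
      ih₂ (node_mem_homog ha₁ v ha₂) hb₁,
      graft_sum_right ha₁ v (mul_mem_homog ha₂ (node_mem_homog hb₁ w hb₂))
        fun u hu => numNodes_of_mem_mulTrees hu,
      graft_sum_left (mul_mem_homog (node_mem_homog ha₁ v ha₂) hb₁) w hb₂
        fun u hu => numNodes_of_mem_mulTrees hu,
      node_mulTrees_node, Multiset.map_add, sum_add, map_map, map_map]
    simp only [Function.comp_def, mul_assoc, T]

theorem RepAt.mul (i : PBT × PBT) :
    RepAt hσ ((treeFrame k V).tensor (treeFrame k V)) (treeFrame k V) mul i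
      ((mulTrees i.1 i.2).map fun u => (u, 1)) where
  deg_eq p hp := by
    obtain ⟨u, hu, rfl⟩ := mem_map.1 hp
    exact numNodes_of_mem_mulTrees hu
  mem_strands p hp := by
    obtain ⟨u, hu, rfl⟩ := mem_map.1 hp
    exact one_mem _
  apply_elt x hx := by
    obtain ⟨s, t⟩ := i
    refine eq_of_homog_mul (m := s.numNodes) (n := t.numNodes)
      (f := BraidedTree.mul ∘ₗ ((treeFrame k V).tensor (treeFrame k V)).elt (s, t))
      (fun a ha b hb => ?_) hx
    have h := Frame.tensor_elt (i := (s, t)) (treeFrame k V) (treeFrame k V) ha hb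
    rw [LinearMap.comp_apply, h, mul_elt ha hb, Frame.ev, map_map,
      ← LinearMap.applyₗ_apply_apply (a * b), map_multiset_sum, map_map]
    simp [Function.comp_def]

theorem Frame.tensor_elt_mul' {i : I × J} {m n : ℕ} (hm : F.deg i.1 = m)
    (hn : G.deg i.2 = n) (y : ⨂[k]^m V ⊗[k] ⨂[k]^n V) :
    (F.tensor G).elt i (LinearMap.mul' k 𝕋 (TensorProduct.map (toTA k V m) (toTA k V n) y)) =
      TensorProduct.map (F.elt i.1 ∘ₗ toTA k V m) (G.elt i.2 ∘ₗ toTA k V n) y := by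
  subst hm hn
  induction y using TensorProduct.induction_on with
  | zero => simp
  | add y z hy hz => simp only [_root_.map_add, hy, hz]
  | tmul a b =>
    rw [TensorProduct.map_tmul, LinearMap.mul'_apply, Frame.tensor_elt F G (toTA_mem _ a)
      (toTA_mem _ b)]
    rfl

theorem RepAt.sigmaBT (i : PBT × PBT) :
    RepAt hσ ((treeFrame k V).tensor (treeFrame k V)) ((treeFrame k V).tensor (treeFrame k V))
      (sigmaBT σ) i {((i.2, i.1), blk i.1.numNodes i.2.numNodes)} where
  deg_eq p hp := by
    rw [mem_singleton.1 hp]; exact add_comm _ _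
  mem_strands p hp := by
    rw [mem_singleton.1 hp]; exact blk_mem_strands le_rfl
  apply_elt x hx := by
    obtain ⟨s, t⟩ := i
    rw [Frame.ev_singleton]
    refine eq_of_homog_mul (m := s.numNodes) (n := t.numNodes)
      (f := BraidedTree.sigmaBT σ ∘ₗ ((treeFrame k V).tensor (treeFrame k V)).elt (s, t))
      (fun a ha b hb => ?_) hx
    have h := Frame.tensor_elt (i := (s, t)) (treeFrame k V) (treeFrame k V) ha hb
    obtain ⟨a, rfl⟩ := ha
    obtain ⟨b, rfl⟩ := hb
    rw [LinearMap.comp_apply, h, treeFrame_elt_toTA, treeFrame_elt_toTA, BraidedTree.sigmaBT,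
      elimL_ofTree, elimR_ofTree, LinearMap.comp_apply, LinearMap.comp_apply,
      ← mul_toTA_beta hσ]
    refine (Eq.trans ?_ (Frame.tensor_elt_mul' (F := treeFrame k V) (G := treeFrame k V)
      (i := (t, s)) rfl rfl _).symm)
    congr 2 <;> exact LinearMap.ext fun a => (treeFrame_elt_toTA _ a).symm

theorem RepAt.sigmaVY (i : Unit × PBT) :
    RepAt hσ ((vecFrame k V).tensor (treeFrame k V)) ((treeFrame k V).tensor (vecFrame k V))
      (sigmaVY σ) i {((i.2, i.1), blk 1 i.2.numNodes)} where
  deg_eq p hp := by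
    rw [mem_singleton.1 hp]; exact add_comm _ _
  mem_strands p hp := by
    rw [mem_singleton.1 hp]; exact blk_mem_strands le_rfl
  apply_elt x hx := by
    obtain ⟨u, t⟩ := i
    rw [Frame.ev_singleton]
    refine eq_of_homog_mul (m := 1) (n := t.numNodes)
      (f := BraidedTree.sigmaVY σ ∘ₗ ((vecFrame k V).tensor (treeFrame k V)).elt (u, t))
      (fun a ha b hb => ?_) hx
    have h := Frame.tensor_elt (i := (u, t)) (vecFrame k V) (treeFrame k V) ha hb
    obtain ⟨v, rfl⟩ := exists_ι ha
    obtain ⟨b, rfl⟩ := hb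
    rw [LinearMap.comp_apply, h, treeFrame_elt_toTA, vecFrame_elt_ι, BraidedTree.sigmaVY,
      elimR_ofTree, LinearMap.comp_apply, LinearMap.comp_apply, LinearMap.comp_apply,
      LinearMap.rTensor_tmul, ← toTA_oneEquiv, ← mul_toTA_beta hσ]
    refine (Eq.trans ?_ (Frame.tensor_elt_mul' (F := treeFrame k V) (G := vecFrame k V)
      (i := (t, u)) rfl rfl _).symm)
    congr 2
    · exact LinearMap.ext fun a => (treeFrame_elt_toTA _ a).symm
    · exact LinearMap.ext fun a =>
        (congrArg (oneEquiv k V).symm (homogComponent_toTA 1 a)).symm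

/-- The root and then the second leg on the left pass the same block; by `blk_add_left` the two
crossings combine into one with `+ 1` strands. -/
theorem RepAt.mulGraft (i : (PBT × PBT) × (Unit × (PBT × PBT))) :
    RepAt hσ (((treeFrame k V).tensor (treeFrame k V)).tensor
        ((vecFrame k V).tensor ((treeFrame k V).tensor (treeFrame k V))))
      ((treeFrame k V).tensor (treeFrame k V)) (mulGraft σ) i
      ((mulTrees i.1.1 i.2.2.1).map fun u => ((u, .node () i.1.2 i.2.2.2),
        shift i.1.1.numNodes (blk (i.1.2.numNodes + 1) i.2.2.1.numNodes))) := by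
  have h₁ (j : Unit × (PBT × PBT)) := RepAt.comp RepAt.assoc
    (RepAt.comp (fun j : (Unit × PBT) × PBT =>
        (RepAt.sigmaVY (hσ := hσ) j.1).rTensor (G := treeFrame k V) j.2)
      (RepAt.assoc_symm (hσ := hσ) (F := vecFrame k V) (G := treeFrame k V)
        (H := treeFrame k V) j))
  refine (RepAt.comp (fun j : (PBT × PBT) × (PBT × (Unit × PBT)) =>
      RepAt.map (RepAt.mul j.1) (RepAt.graft j.2))
    (RepAt.comp (fun j : (PBT × PBT) × (PBT × (Unit × PBT)) => RepAt.opMid RepAt.sigmaBT j)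
      (RepAt.lTensor i.1 (h₁ i.2)))).congr ?_
  simp [bind_singleton, blk_add_left]

theorem RepAt.comul (t : PBT) :
    RepAt hσ (treeFrame k V) ((treeFrame k V).tensor (treeFrame k V)) (comul σ) t (cuts t) := by
  induction t with
  | nil =>
    refine ⟨by simp, by simp, fun x hx => ?_⟩
    obtain ⟨c, rfl⟩ := exists_algebraMap hx
    have h := Frame.tensor_elt (i := (.nil, .nil)) (treeFrame k V) (treeFrame k V) hx one_mem_homog
    rw [mul_one, treeFrame_elt_one] at h
    rw [cuts_nil, Frame.ev_singleton, map_one, LinearMap.comp_apply, Module.End.one_apply, h,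
      treeFrame_elt_algebraMap, map_smul, comul_leaf, TensorProduct.smul_tmul']
  | node u l r ihl ihr =>
    refine ⟨fun p hp => (cuts_spec hp).1, fun p hp => (cuts_spec hp).2, fun x hx => ?_⟩
    have h := (RepAt.comp RepAt.mulGraft (RepAt.map ihl (RepAt.map (RepAt.id (F := vecFrame k V) ())
      ihr))).congr (T := nodeCuts l.numNodes (cuts l) (cuts r)) (by
        simp [nodeCuts, Multiset.bind_assoc, Multiset.bind_map, mul_assoc])
    refine eq_of_homog_node (f := BraidedTree.comul σ ∘ₗ (treeFrame k V).elt (.node () l r))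
      (fun a ha v b hb => ?_) hx
    have hab := node_mem_homog ha v hb
    have h₁ := graft_elt ha v hb
    have h₂ := Frame.tensor_elt (i := (l, ((), r))) (treeFrame k V)
      ((vecFrame k V).tensor (treeFrame k V)) ha (mul_mem_homog (ι_mem v) hb)
    have h₃ := Frame.tensor_elt (i := ((), r)) (vecFrame k V) (treeFrame k V) (ι_mem v) hb
    rw [vecFrame_elt_ι] at h₃
    have h₄ := h.apply_elt _ (mul_mem_homog ha (mul_mem_homog (ι_mem v) hb))
    rw [LinearMap.comp_apply, h₂, h₃, TensorProduct.map_tmul, TensorProduct.map_tmul,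
      LinearMap.id_apply] at h₄
    have h₅ := Frame.tensor_elt (i := (.node () l r, .nil)) (treeFrame k V) (treeFrame k V) hab
      one_mem_homog
    rw [treeFrame_elt_one, mul_one] at h₅
    rw [LinearMap.comp_apply, ← h₁, comul_graft, h₁, cuts_node, Frame.ev_add, Frame.ev_singleton,
      map_one, LinearMap.add_apply, LinearMap.comp_apply, Module.End.one_apply, h₅, ← h₄]

@[simp]
theorem counit_leaf : counit (leaf : TreeSpace k V) = 1 := by
  rw [leaf, BraidedTree.counit, elim_ofTree, counitAux]
  exact LinearEquiv.apply_symm_apply _ _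

theorem RepAt.counit (t : PBT) :
    RepAt hσ (treeFrame k V) (scalarFrame k V) counit t (counitTrees t) := by
  cases t with
  | nil =>
    refine ⟨by simp, by simp, fun x hx => ?_⟩
    obtain ⟨c, rfl⟩ := exists_algebraMap hx
    rw [treeFrame_elt_algebraMap, map_smul, counit_leaf, counitTrees_nil, Frame.ev_singleton,
      map_one, LinearMap.comp_apply, Module.End.one_apply, scalarFrame_elt_algebraMap, smul_eq_mul,
      mul_one]
  | node u l r =>
    refine ⟨by simp, by simp, fun x hx => ?_⟩
    obtain ⟨a, rfl⟩ := hx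
    refine (congrArg BraidedTree.counit (treeFrame_elt_toTA (.node u l r) a)).trans ?_
    rw [BraidedTree.counit]
    refine (elim_ofTree _ _ _).trans ?_
    rw [counitTrees_node, Frame.ev_zero]
    rfl

end StructureMaps

/-! ### The braided bialgebra of decorated trees -/

section Bialgebra

open Multiset PosBraid

variable {k : Type*} [CommSemiring k] {V : Type*} [AddCommMonoid V] [Module k V]
  {σ : V ⊗[k] V →ₗ[k] V ⊗[k] V}

/-- Two of the three crossings on each side combine into the passage of the first two blocks past
the third; what remains is naturality of that passage with respect to the crossing of the first two.
-/
theorem isBraiding_sigmaBT (hσ : IsBraiding σ) : IsBraiding (sigmaBT σ) := by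
  have h₁ := RepAt.op₁ (RepAt.sigmaBT (hσ := hσ))
  have h₂ := RepAt.op₂ (RepAt.sigmaBT (hσ := hσ))
  refine eq_of_repAt_of_eq (fun i => RepAt.comp h₁ (RepAt.comp h₂ (h₁ i)))
    (fun i => RepAt.comp h₂ (RepAt.comp h₁ (h₂ i))) ?_
  rintro ⟨⟨s, t⟩, u⟩
  simp only [map_singleton, singleton_bind, treeFrame_deg, singleton_inj, Prod.mk.injEq, true_and]
  rw [← mul_assoc, ← blk_add_left, ← blk_add_left, ← blk_mul (blk_mem_strands le_rfl),
    add_comm t.numNodes]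

theorem mul_assoc_tree (hσ : IsBraiding σ) : (mul (k := k) (V := V)) ∘ₗ mul.rTensor _ =
    mul ∘ₗ mul.lTensor _ ∘ₗ (TensorProduct.assoc k _ _ _).toLinearMap := by
  refine eq_of_repAt_of_eq (hσ := hσ)
    (fun i : (PBT × PBT) × PBT => RepAt.comp RepAt.mul ((RepAt.mul i.1).rTensor i.2))
    (fun i => RepAt.comp RepAt.mul
      (RepAt.comp (fun j : PBT × (PBT × PBT) => (RepAt.mul j.2).lTensor j.1) (RepAt.assoc i))) ?_
  rintro ⟨⟨s, t⟩, u⟩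
  have := congrArg (Multiset.map fun u => (u, (1 : PosBraid))) (mulTrees_assoc s t u)
  simpa [Multiset.bind_map, Multiset.map_bind] using this

/-- The product adds no braid, so this is just the splitting of a block crossing along its second
block. -/
theorem braid_mul_right_tree (hσ : IsBraiding σ) :
    mul.rTensor _ ∘ₗ op₂ (sigmaBT σ) ∘ₗ op₁ (sigmaBT σ) =
      sigmaBT σ ∘ₗ mul.lTensor _ ∘ₗ (TensorProduct.assoc k _ _ _).toLinearMap := by
  have h₁ := RepAt.op₁ (RepAt.sigmaBT (hσ := hσ))
  have h₂ := RepAt.op₂ (RepAt.sigmaBT (hσ := hσ))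
  refine eq_of_repAt_of_eq
    (fun i => RepAt.comp (fun j : (PBT × PBT) × PBT => (RepAt.mul j.1).rTensor j.2)
      (RepAt.comp h₂ (h₁ i)))
    (fun i => RepAt.comp RepAt.sigmaBT
      (RepAt.comp (fun j : PBT × (PBT × PBT) => (RepAt.mul j.2).lTensor j.1) (RepAt.assoc i))) ?_
  rintro ⟨⟨s, t⟩, u⟩
  simp only [map_singleton, singleton_bind, treeFrame_deg, map_map,
    Function.comp_def, bind_singleton, map_one, one_mul, mul_one]
  refine map_congr rfl fun v hv => ?_
  rw [numNodes_of_mem_mulTrees hv, blk_add_right]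

theorem braid_mul_left_tree (hσ : IsBraiding σ) :
    mul.lTensor _ ∘ₗ (TensorProduct.assoc k _ _ _).toLinearMap ∘ₗ op₁ (sigmaBT σ) ∘ₗ
      op₂ (sigmaBT σ) = sigmaBT σ ∘ₗ mul.rTensor _ := by
  have h₁ := RepAt.op₁ (RepAt.sigmaBT (hσ := hσ))
  have h₂ := RepAt.op₂ (RepAt.sigmaBT (hσ := hσ))
  refine eq_of_repAt_of_eq
    (fun i => RepAt.comp (fun j : PBT × (PBT × PBT) => (RepAt.mul j.2).lTensor j.1)
      (RepAt.comp RepAt.assoc (RepAt.comp h₁ (h₂ i))))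
    (fun i : (PBT × PBT) × PBT => RepAt.comp RepAt.sigmaBT ((RepAt.mul i.1).rTensor i.2)) ?_
  rintro ⟨⟨s, t⟩, u⟩
  simp only [map_singleton, singleton_bind, treeFrame_deg, map_map,
    Function.comp_def, bind_singleton, map_one, one_mul, mul_one]
  refine map_congr rfl fun v hv => ?_
  rw [numNodes_of_mem_mulTrees hv, blk_add_left]

theorem coassoc_tree (hσ : IsBraiding σ) :
    (TensorProduct.assoc k _ _ _).toLinearMap ∘ₗ (comul σ).rTensor _ ∘ₗ comul σ =
      (comul σ).lTensor _ ∘ₗ comul σ := by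
  refine eq_of_repAt_of_eq (hσ := hσ)
    (fun t => RepAt.comp RepAt.assoc (RepAt.comp
      (fun j : PBT × PBT => (RepAt.comul j.1).rTensor j.2) (RepAt.comul t)))
    (fun t => RepAt.comp (fun j : PBT × PBT => (RepAt.comul j.2).lTensor j.1) (RepAt.comul t)) ?_
  intro t
  have := coassocLeft_eq_coassocRight t
  simpa [coassocLeft, coassocRight, Multiset.map_bind, bind_singleton] using this

theorem counit_left_tree (hσ : IsBraiding σ) :
    (TensorProduct.lid k _).toLinearMap ∘ₗ counit.rTensor _ ∘ₗ comul σ = LinearMap.id := by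
  refine eq_of_repAt_of_eq (hσ := hσ)
    (fun t => RepAt.comp RepAt.lid (RepAt.comp
      (fun j : PBT × PBT => (RepAt.counit j.1).rTensor j.2) (RepAt.comul t)))
    (fun t => RepAt.id t) ?_
  intro t
  rw [← cuts_counit_left]
  simp only [Multiset.map_bind, map_singleton, bind_singleton, map_map,
    Function.comp_def, one_mul]
  refine bind_congr fun c _ => ?_
  rcases c with ⟨⟨_ | _, _⟩, _⟩ <;> simp

theorem counit_right_tree (hσ : IsBraiding σ) :
    (TensorProduct.rid k _).toLinearMap ∘ₗ counit.lTensor _ ∘ₗ comul σ = LinearMap.id := by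
  refine eq_of_repAt_of_eq (hσ := hσ)
    (fun t => RepAt.comp RepAt.rid (RepAt.comp
      (fun j : PBT × PBT => (RepAt.counit j.2).lTensor j.1) (RepAt.comul t)))
    (fun t => RepAt.id t) ?_
  intro t
  rw [← cuts_counit_right]
  simp only [Multiset.map_bind, map_singleton, bind_singleton, map_map,
    Function.comp_def, one_mul]
  refine bind_congr fun c _ => ?_
  rcases c with ⟨⟨_, _ | _⟩, _⟩ <;> simp

/-- The braid of a cut lies inside the first block and slides through the crossing; the crossing
itself splits along the two legs. -/
theorem braid_comul_left_tree (hσ : IsBraiding σ) :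
    op₁ (sigmaBT σ) ∘ₗ op₂ (sigmaBT σ) ∘ₗ (comul σ).rTensor _ =
      (TensorProduct.assoc k _ _ _).symm.toLinearMap ∘ₗ (comul σ).lTensor _ ∘ₗ sigmaBT σ := by
  have h₁ := RepAt.op₁ (RepAt.sigmaBT (hσ := hσ))
  have h₂ := RepAt.op₂ (RepAt.sigmaBT (hσ := hσ))
  refine eq_of_repAt_of_eq
    (fun i : PBT × PBT => RepAt.comp h₁ (RepAt.comp h₂ ((RepAt.comul i.1).rTensor i.2)))
    (fun i => RepAt.comp RepAt.assoc_symm (RepAt.comp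
      (fun j : PBT × PBT => (RepAt.comul j.2).lTensor j.1) (RepAt.sigmaBT i))) ?_
  rintro ⟨t, s⟩
  simp only [map_singleton, singleton_bind, treeFrame_deg, map_map,
    Function.comp_def, bind_singleton, one_mul]
  refine map_congr rfl fun c hc => ?_
  obtain ⟨hc₁, hc₂⟩ := cuts_spec hc
  rw [← blk_mul hc₂, ← hc₁, blk_add_left, mul_assoc]

theorem braid_comul_right_tree (hσ : IsBraiding σ) :
    op₂ (sigmaBT σ) ∘ₗ op₁ (sigmaBT σ) ∘ₗ (TensorProduct.assoc k _ _ _).symm.toLinearMap ∘ₗ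
      (comul σ).lTensor _ = (comul σ).rTensor _ ∘ₗ sigmaBT σ := by
  have h₁ := RepAt.op₁ (RepAt.sigmaBT (hσ := hσ))
  have h₂ := RepAt.op₂ (RepAt.sigmaBT (hσ := hσ))
  refine eq_of_repAt_of_eq
    (fun i : PBT × PBT => RepAt.comp h₂ (RepAt.comp h₁ (RepAt.comp RepAt.assoc_symm
      ((RepAt.comul i.2).lTensor i.1))))
    (fun i => RepAt.comp (fun j : PBT × PBT => (RepAt.comul j.1).rTensor j.2)
      (RepAt.sigmaBT i)) ?_
  rintro ⟨t, s⟩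
  simp only [map_singleton, singleton_bind, treeFrame_deg, map_map,
    Function.comp_def, bind_singleton, one_mul]
  refine map_congr rfl fun c hc => ?_
  obtain ⟨hc₁, hc₂⟩ := cuts_spec hc
  rw [← blk_mul_shift hc₂, ← hc₁, blk_add_right, mul_assoc]

theorem braid_counit_left_tree (hσ : IsBraiding σ) :
    (TensorProduct.lid k _).toLinearMap ∘ₗ counit.rTensor _ ∘ₗ sigmaBT σ =
      (TensorProduct.rid k _).toLinearMap ∘ₗ counit.lTensor _ := by
  refine eq_of_repAt_of_eq (hσ := hσ)
    (fun i => RepAt.comp RepAt.lid (RepAt.comp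
      (fun j : PBT × PBT => (RepAt.counit j.1).rTensor j.2) (RepAt.sigmaBT i)))
    (fun i : PBT × PBT => RepAt.comp RepAt.rid ((RepAt.counit i.2).lTensor i.1)) ?_
  rintro ⟨s, _ | _⟩ <;> simp

theorem braid_counit_right_tree (hσ : IsBraiding σ) :
    (TensorProduct.rid k _).toLinearMap ∘ₗ counit.lTensor _ ∘ₗ sigmaBT σ =
      (TensorProduct.lid k _).toLinearMap ∘ₗ counit.rTensor _ := by
  refine eq_of_repAt_of_eq (hσ := hσ)
    (fun i => RepAt.comp RepAt.rid (RepAt.comp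
      (fun j : PBT × PBT => (RepAt.counit j.2).lTensor j.1) (RepAt.sigmaBT i)))
    (fun i : PBT × PBT => RepAt.comp RepAt.lid ((RepAt.counit i.1).rTensor i.2)) ?_
  rintro ⟨_ | _, s⟩ <;> simp

theorem comul_mul_tree (hσ : IsBraiding σ) :
    comul σ ∘ₗ mul = TensorProduct.map mul mul ∘ₗ opMid (sigmaBT σ) ∘ₗ
      TensorProduct.map (comul σ) (comul σ) := by
  refine eq_of_repAt_of_eq (hσ := hσ) (fun i => RepAt.comp RepAt.comul (RepAt.mul i))
    (fun i : PBT × PBT => RepAt.comp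
      (fun j : (PBT × PBT) × (PBT × PBT) => RepAt.map (RepAt.mul j.1) (RepAt.mul j.2))
      (RepAt.comp (RepAt.opMid RepAt.sigmaBT)
        (RepAt.map (RepAt.comul i.1) (RepAt.comul i.2)))) ?_
  rintro ⟨s, t⟩
  have := mulTrees_bind_cuts s t
  simpa [mulCuts, Multiset.bind_map, Multiset.bind_assoc, Multiset.map_bind, bind_singleton,
    mul_assoc, Function.comp_def] using this

theorem counit_mul_tree (hσ : IsBraiding σ) :
    counit ∘ₗ mul = (TensorProduct.lid k k).toLinearMap ∘ₗ
      TensorProduct.map (counit (k := k) (V := V)) counit := by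
  refine eq_of_repAt_of_eq (hσ := hσ) (fun i => RepAt.comp RepAt.counit (RepAt.mul i))
    (fun i : PBT × PBT => RepAt.comp RepAt.lid
      (RepAt.map (RepAt.counit i.1) (RepAt.counit i.2))) ?_
  rintro ⟨s, t⟩
  have := mulTrees_bind_counitTrees s t fun _ e => e
  -- Unless both trees are `|`, both sides are empty sums.
  rcases s with _ | _ <;> rcases t with _ | _ <;>
    simp_all [Multiset.bind_map]

/-- The factor `1` is kept because `Frame.tensor_elt` evaluates only on explicit products of
homogeneous elements. -/
theorem treeFrame_tensor_nil_left (t : PBT) {x : TensorAlgebra k V}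
    (hx : x ∈ homog k V t.numNodes) :
    ((treeFrame k V).tensor (treeFrame k V)).elt (.nil, t) (1 * x) =
      leaf ⊗ₜ (treeFrame k V).elt t x := by
  have h := Frame.tensor_elt (i := (.nil, t)) (treeFrame k V) (treeFrame k V) one_mem_homog hx
  rw [h, treeFrame_elt_one]

theorem treeFrame_tensor_nil_right (t : PBT) {x : TensorAlgebra k V}
    (hx : x ∈ homog k V t.numNodes) :
    ((treeFrame k V).tensor (treeFrame k V)).elt (t, .nil) (x * 1) =
      (treeFrame k V).elt t x ⊗ₜ leaf := by
  have h := Frame.tensor_elt (i := (t, .nil)) (treeFrame k V) (treeFrame k V) hx one_mem_homog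
  rw [h, treeFrame_elt_one]

theorem sigmaBT_leaf_left (hσ : IsBraiding σ) (y : TreeSpace k V) :
    sigmaBT σ (leaf ⊗ₜ y) = y ⊗ₜ leaf := by
  refine LinearMap.congr_fun (f := sigmaBT σ ∘ₗ TensorProduct.mk k _ _ leaf)
    (g := (TensorProduct.mk k _ _).flip leaf) ((treeFrame k V).hom_ext fun t x hx => ?_) y
  have h := ((RepAt.sigmaBT (hσ := hσ) (.nil, t)).congr (T := {((t, .nil), 1)})
    (by simp)).apply_elt (1 * x) (mul_mem_homog one_mem_homog hx)
  rw [Frame.ev_singleton, map_one, LinearMap.comp_apply, Module.End.one_apply,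
    treeFrame_tensor_nil_left t hx, one_mul, ← mul_one x, treeFrame_tensor_nil_right t hx] at h
  simpa using h

theorem sigmaBT_leaf_right (hσ : IsBraiding σ) (y : TreeSpace k V) :
    sigmaBT σ (y ⊗ₜ leaf) = leaf ⊗ₜ y := by
  refine LinearMap.congr_fun (f := sigmaBT σ ∘ₗ (TensorProduct.mk k _ _).flip leaf)
    (g := TensorProduct.mk k _ _ leaf) ((treeFrame k V).hom_ext fun t x hx => ?_) y
  have h := ((RepAt.sigmaBT (hσ := hσ) (t, .nil)).congr (T := {((.nil, t), 1)})
    (by simp)).apply_elt (x * 1) (mul_mem_homog hx one_mem_homog)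
  rw [Frame.ev_singleton, map_one, LinearMap.comp_apply, Module.End.one_apply,
    treeFrame_tensor_nil_right t hx, mul_one, ← one_mul x, treeFrame_tensor_nil_left t hx] at h
  simpa using h

theorem isBraidedBialgebra_tree (hσ : IsBraiding σ) :
    IsBraidedBialgebra (mul (k := k) (V := V)) leaf (comul σ) counit (sigmaBT σ) where
  algebra :=
    { braiding := isBraiding_sigmaBT hσ
      mul_assoc a b c := LinearMap.congr_fun (mul_assoc_tree hσ) ((a ⊗ₜ b) ⊗ₜ c)
      one_mul := leaf_mul
      mul_one := mul_leaf
      braid_mul_right := braid_mul_right_tree hσ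
      braid_mul_left := braid_mul_left_tree hσ
      braid_one_right := sigmaBT_leaf_right hσ
      braid_one_left := sigmaBT_leaf_left hσ }
  coalgebra :=
    { braiding := isBraiding_sigmaBT hσ
      coassoc := coassoc_tree hσ
      counit_left := counit_left_tree hσ
      counit_right := counit_right_tree hσ
      braid_comul_left := braid_comul_left_tree hσ
      braid_comul_right := braid_comul_right_tree hσ
      braid_counit_left := braid_counit_left_tree hσ
      braid_counit_right := braid_counit_right_tree hσ }
  comul_mul := comul_mul_tree hσ
  comul_one := comul_leaf σ
  counit_mul a b := LinearMap.congr_fun (counit_mul_tree hσ) (a ⊗ₜ b)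
  counit_one := counit_leaf

end Bialgebra

/-! ### The antipode -/

section Antipode

open PosBraid

variable {k : Type*} [CommRing k] {V : Type*} [AddCommGroup V] [Module k V]
  {σ : V ⊗[k] V →ₗ[k] V ⊗[k] V}

local notation "ℋ" => TreeSpace k V

theorem add_neg_one_smul {M : Type*} [AddCommMonoid M] [Module k M] (x : M) :
    x + (-1 : k) • x = 0 := by
  nth_rewrite 1 [← one_smul k x]
  rw [← add_smul, add_neg_cancel, zero_smul]

/-- Cancellation expressed with the scalar `-1`, since the additive structure used on the tree space
is that of a commutative monoid. -/
theorem eq_of_eq_add_add_neg {M : Type*} [AddCommMonoid M] [Module k M] {a u x : M}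
    (h : a = u + (a + (-1 : k) • x)) : x = u := by
  have h' := congrArg (fun y => y + x + (-1 : k) • a) h
  calc x = a + (-1 : k) • a + x := by rw [add_neg_one_smul, zero_add]
    _ = a + x + (-1 : k) • a := add_right_comm _ _ _
    _ = u + (a + (-1 : k) • x) + x + (-1 : k) • a := h'
    _ = u + (a + (-1 : k) • a) + (x + (-1 : k) • x) := by abel
    _ = u := by rw [add_neg_one_smul, add_neg_one_smul, add_zero, add_zero]

variable (σ) in
/-- The convolution product of linear maps. -/
def conv (f g : ℋ →ₗ[k] ℋ) : ℋ →ₗ[k] ℋ := mul ∘ₗ TensorProduct.map f g ∘ₗ comul σ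

variable (k V) in
/-- The unit of the convolution product. -/
def convUnit : ℋ →ₗ[k] ℋ := LinearMap.toSpanSingleton k ℋ leaf ∘ₗ counit

theorem conv_add_left (f f' g : ℋ →ₗ[k] ℋ) : conv σ (f + f') g = conv σ f g + conv σ f' g := by
  simp only [conv, TensorProduct.map_add_left, LinearMap.add_comp, LinearMap.comp_add]

theorem conv_add_right (f g g' : ℋ →ₗ[k] ℋ) : conv σ f (g + g') = conv σ f g + conv σ f g' := by
  simp only [conv, TensorProduct.map_add_right, LinearMap.add_comp, LinearMap.comp_add]

theorem conv_smul_left (c : k) (f g : ℋ →ₗ[k] ℋ) : conv σ (c • f) g = c • conv σ f g := by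
  simp only [conv, TensorProduct.map_smul_left, LinearMap.smul_comp, LinearMap.comp_smul]

theorem conv_smul_right (c : k) (f g : ℋ →ₗ[k] ℋ) : conv σ f (c • g) = c • conv σ f g := by
  simp only [conv, TensorProduct.map_smul_right, LinearMap.smul_comp, LinearMap.comp_smul]

theorem conv_assoc (hσ : IsBraiding σ) (f g h : ℋ →ₗ[k] ℋ) :
    conv σ (conv σ f g) h = conv σ f (conv σ g h) := by
  have h₁ : TensorProduct.map (conv σ f g) h = mul.rTensor _ ∘ₗ
      TensorProduct.map (TensorProduct.map f g) h ∘ₗ (comul σ).rTensor _ := by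
    rw [conv, LinearMap.rTensor, LinearMap.rTensor, ← TensorProduct.map_comp,
      ← TensorProduct.map_comp]
    rfl
  have h₂ : TensorProduct.map f (conv σ g h) = mul.lTensor _ ∘ₗ
      TensorProduct.map f (TensorProduct.map g h) ∘ₗ (comul σ).lTensor _ := by
    rw [conv, LinearMap.lTensor, LinearMap.lTensor, ← TensorProduct.map_comp,
      ← TensorProduct.map_comp]
    rfl
  have h₃ : (TensorProduct.assoc k ℋ ℋ ℋ).toLinearMap ∘ₗ
      TensorProduct.map (TensorProduct.map f g) h =
      TensorProduct.map f (TensorProduct.map g h) ∘ₗ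
        (TensorProduct.assoc k ℋ ℋ ℋ).toLinearMap :=
    TensorProduct.ext_threefold fun _ _ _ => rfl
  calc conv σ (conv σ f g) h = (mul ∘ₗ mul.rTensor _) ∘ₗ
        TensorProduct.map (TensorProduct.map f g) h ∘ₗ (comul σ).rTensor _ ∘ₗ comul σ := by
        rw [conv, h₁]; rfl
    _ = mul ∘ₗ mul.lTensor _ ∘ₗ ((TensorProduct.assoc k ℋ ℋ ℋ).toLinearMap ∘ₗ
        TensorProduct.map (TensorProduct.map f g) h) ∘ₗ (comul σ).rTensor _ ∘ₗ comul σ := by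
        rw [mul_assoc_tree hσ]; rfl
    _ = mul ∘ₗ mul.lTensor _ ∘ₗ TensorProduct.map f (TensorProduct.map g h) ∘ₗ
        (TensorProduct.assoc k ℋ ℋ ℋ).toLinearMap ∘ₗ (comul σ).rTensor _ ∘ₗ comul σ := by
        rw [h₃]; rfl
    _ = conv σ f (conv σ g h) := by rw [coassoc_tree hσ, conv, h₂]; rfl

theorem convUnit_conv (hσ : IsBraiding σ) (f : ℋ →ₗ[k] ℋ) : conv σ (convUnit k V) f = f := by
  have h : mul ∘ₗ TensorProduct.map (convUnit k V) f =
      f ∘ₗ (TensorProduct.lid k ℋ).toLinearMap ∘ₗ counit.rTensor _ := by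
    refine TensorProduct.ext' fun x y => ?_
    simp [convUnit, ← TensorProduct.smul_tmul', leaf_mul]
  rw [conv, ← LinearMap.comp_assoc, h, LinearMap.comp_assoc, LinearMap.comp_assoc,
    counit_left_tree hσ, LinearMap.comp_id]

theorem conv_convUnit (hσ : IsBraiding σ) (f : ℋ →ₗ[k] ℋ) : conv σ f (convUnit k V) = f := by
  have h : mul ∘ₗ TensorProduct.map f (convUnit k V) =
      f ∘ₗ (TensorProduct.rid k ℋ).toLinearMap ∘ₗ counit.lTensor _ := by
    refine TensorProduct.ext' fun x y => ?_
    simp [convUnit, mul_leaf]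
  rw [conv, ← LinearMap.comp_assoc, h, LinearMap.comp_assoc, LinearMap.comp_assoc,
    counit_right_tree hσ, LinearMap.comp_id]

theorem conv_elt (hσ : IsBraiding σ) (f g : ℋ →ₗ[k] ℋ) {t : PBT} {x : TensorAlgebra k V}
    (hx : x ∈ homog k V t.numNodes) :
    conv σ f g ((treeFrame k V).elt t x) = ((cuts t).map fun c => (mul ∘ₗ TensorProduct.map f g)
      (((treeFrame k V).tensor (treeFrame k V)).elt c.1 (act hσ c.2 x))).sum := by
  have h := (RepAt.comul (hσ := hσ) t).apply_elt x hx
  rw [conv, ← LinearMap.comp_assoc, LinearMap.comp_apply, h, Frame.ev,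
    ← LinearMap.applyₗ_apply_apply x, map_multiset_sum, map_multiset_sum, Multiset.map_map,
    Multiset.map_map]
  rfl

theorem map_elt_nil {f : ℋ →ₗ[k] ℋ} (hf : f leaf = 0) {x : TensorAlgebra k V}
    (hx : x ∈ homog k V 0) : f ((treeFrame k V).elt .nil x) = 0 := by
  obtain ⟨c, rfl⟩ := exists_algebraMap hx
  rw [treeFrame_elt_algebraMap, map_smul, hf, smul_zero]

/-- In each term of the coproduct the second leg is either `|`, which `g` kills, or has a vertex,
which leaves fewer vertices for the first leg. So only the values of `f` on smaller trees matter. -/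
theorem conv_congr_left (hσ : IsBraiding σ) {f f' g : ℋ →ₗ[k] ℋ} (hg : g leaf = 0) {t : PBT}
    (h : ∀ s : PBT, s.numNodes < t.numNodes → ∀ y ∈ homog k V s.numNodes,
      f ((treeFrame k V).elt s y) = f' ((treeFrame k V).elt s y))
    {x : TensorAlgebra k V} (hx : x ∈ homog k V t.numNodes) :
    conv σ f g ((treeFrame k V).elt t x) = conv σ f' g ((treeFrame k V).elt t x) := by
  rw [conv_elt hσ f g hx, conv_elt hσ f' g hx]
  refine congrArg _ (Multiset.map_congr rfl fun c hc => ?_)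
  have hc := (cuts_spec hc).1
  have hx' : act hσ c.2 x ∈ homog k V (c.1.1.numNodes + c.1.2.numNodes) := by
    rw [hc]; exact act_mem hσ _ hx
  refine eq_of_homog_mul
    (f := (mul ∘ₗ TensorProduct.map f g) ∘ₗ ((treeFrame k V).tensor (treeFrame k V)).elt c.1)
    (g := (mul ∘ₗ TensorProduct.map f' g) ∘ₗ ((treeFrame k V).tensor (treeFrame k V)).elt c.1)
    (fun a ha b hb => ?_) hx'
  simp only [LinearMap.comp_apply, Frame.tensor_elt (treeFrame k V) (treeFrame k V) ha hb,
    TensorProduct.map_tmul]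
  obtain ⟨⟨p, q⟩, w⟩ := c
  cases q with
  | nil => rw [map_elt_nil hg hb, TensorProduct.tmul_zero, TensorProduct.tmul_zero]
  | node u l r => rw [h p (by simp only [numNodes_node] at hc; omega) a ha]

theorem conv_congr_right (hσ : IsBraiding σ) {f g g' : ℋ →ₗ[k] ℋ} (hf : f leaf = 0) {t : PBT}
    (h : ∀ s : PBT, s.numNodes < t.numNodes → ∀ y ∈ homog k V s.numNodes,
      g ((treeFrame k V).elt s y) = g' ((treeFrame k V).elt s y))
    {x : TensorAlgebra k V} (hx : x ∈ homog k V t.numNodes) :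
    conv σ f g ((treeFrame k V).elt t x) = conv σ f g' ((treeFrame k V).elt t x) := by
  rw [conv_elt hσ f g hx, conv_elt hσ f g' hx]
  refine congrArg _ (Multiset.map_congr rfl fun c hc => ?_)
  have hc := (cuts_spec hc).1
  have hx' : act hσ c.2 x ∈ homog k V (c.1.1.numNodes + c.1.2.numNodes) := by
    rw [hc]; exact act_mem hσ _ hx
  refine eq_of_homog_mul
    (f := (mul ∘ₗ TensorProduct.map f g) ∘ₗ ((treeFrame k V).tensor (treeFrame k V)).elt c.1)
    (g := (mul ∘ₗ TensorProduct.map f g') ∘ₗ ((treeFrame k V).tensor (treeFrame k V)).elt c.1)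
    (fun a ha b hb => ?_) hx'
  simp only [LinearMap.comp_apply, Frame.tensor_elt (treeFrame k V) (treeFrame k V) ha hb,
    TensorProduct.map_tmul]
  obtain ⟨⟨p, q⟩, w⟩ := c
  cases p with
  | nil => rw [map_elt_nil hf ha, TensorProduct.zero_tmul, TensorProduct.zero_tmul]
  | node u l r => rw [h q (by simp only [numNodes_node] at hc; omega) b hb]

/-! ### The geometric series defining the antipode. -/

variable (k V) in
/-- The difference of the convolution unit and the identity. -/
def unitSubId : ℋ →ₗ[k] ℋ := convUnit k V + (-1 : k) • LinearMap.id

theorem unitSubId_leaf : unitSubId k V leaf = 0 := by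
  simp [unitSubId, convUnit, add_neg_one_smul]

variable (σ) in
/-- The convolution powers of `unitSubId`. -/
def convPow : ℕ → (ℋ →ₗ[k] ℋ)
  | 0 => convUnit k V
  | n + 1 => conv σ (convPow n) (unitSubId k V)

/-- Powers are built by convolving on the right; this form is needed for the other one-sided
inverse. -/
theorem conv_convPow (hσ : IsBraiding σ) (n : ℕ) :
    conv σ (unitSubId k V) (convPow σ n) = convPow σ (n + 1) := by
  induction n with
  | zero => rw [convPow, convPow, convPow, conv_convUnit hσ, convUnit_conv hσ]
  | succ n ih => rw [convPow, ← conv_assoc hσ, ih, ← convPow]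

/-- Local nilpotence: each convolution with `unitSubId` uses up at least one vertex. -/
theorem convPow_elt_eq_zero (hσ : IsBraiding σ) {n : ℕ} {t : PBT} (h : t.numNodes < n)
    {x : TensorAlgebra k V} (hx : x ∈ homog k V t.numNodes) :
    convPow σ n ((treeFrame k V).elt t x) = 0 := by
  induction n generalizing t x with
  | zero => omega
  | succ n ih =>
    rw [convPow, conv_congr_left hσ (f' := 0) unitSubId_leaf
      (fun s hs y hy => by rw [ih (by omega) hy, LinearMap.zero_apply]) hx]
    simp [conv]

variable (σ) in
/-- The antipode, as a locally finite sum of convolution powers. -/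
def antipode : ℋ →ₗ[k] ℋ :=
  elim fun t => (∑ n ∈ Finset.range (t.numNodes + 1), convPow σ n) ∘ₗ ofTree t

theorem antipode_elt (t : PBT) {x : TensorAlgebra k V} (hx : x ∈ homog k V t.numNodes) :
    antipode σ ((treeFrame k V).elt t x) =
      (∑ n ∈ Finset.range (t.numNodes + 1), convPow σ n) ((treeFrame k V).elt t x) := by
  obtain ⟨a, rfl⟩ := hx
  rw [treeFrame_elt_toTA, antipode, elim_ofTree]
  rfl

theorem antipode_elt_of_lt (hσ : IsBraiding σ) {s : PBT} {N : ℕ} (h : s.numNodes < N)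
    {y : TensorAlgebra k V} (hy : y ∈ homog k V s.numNodes) :
    antipode σ ((treeFrame k V).elt s y) =
      (∑ n ∈ Finset.range N, convPow σ n) ((treeFrame k V).elt s y) := by
  rw [antipode_elt s hy, LinearMap.sum_apply, LinearMap.sum_apply]
  refine Finset.sum_subset (Finset.range_mono h) fun n _ hn => convPow_elt_eq_zero hσ ?_ hy
  simpa using hn

theorem sum_conv (s : Finset ℕ) (f : ℕ → ℋ →ₗ[k] ℋ) (g : ℋ →ₗ[k] ℋ) :
    conv σ (∑ n ∈ s, f n) g = ∑ n ∈ s, conv σ (f n) g := by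
  refine map_sum (⟨⟨fun f => conv σ f g, ?_⟩, fun f f' => conv_add_left f f' g⟩ :
    (ℋ →ₗ[k] ℋ) →+ (ℋ →ₗ[k] ℋ)) f s
  simp [conv]

theorem conv_sum (s : Finset ℕ) (f : ℕ → ℋ →ₗ[k] ℋ) (g : ℋ →ₗ[k] ℋ) :
    conv σ g (∑ n ∈ s, f n) = ∑ n ∈ s, conv σ g (f n) := by
  refine map_sum (⟨⟨fun f => conv σ g f, ?_⟩, fun f f' => conv_add_right g f f'⟩ :
    (ℋ →ₗ[k] ℋ) →+ (ℋ →ₗ[k] ℋ)) f s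
  simp [conv]

/-- The equation of a geometric series. On smaller trees the powers below `t.numNodes` already give
the antipode; one more convolution yields the powers from `1` to `t.numNodes`, and `convUnit`
supplies the power `0`. -/
theorem antipode_eq_left (hσ : IsBraiding σ) :
    antipode σ = convUnit k V + conv σ (antipode σ) (unitSubId k V) := by
  refine (treeFrame k V).hom_ext fun t x hx => ?_
  rw [LinearMap.add_apply, conv_congr_left hσ unitSubId_leaf
    (fun s hs y hy => antipode_elt_of_lt hσ hs hy) hx, sum_conv, antipode_elt t hx,
    Finset.sum_range_succ', add_comm]
  rfl

theorem antipode_eq_right (hσ : IsBraiding σ) :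
    antipode σ = convUnit k V + conv σ (unitSubId k V) (antipode σ) := by
  refine (treeFrame k V).hom_ext fun t x hx => ?_
  rw [LinearMap.add_apply, conv_congr_right hσ unitSubId_leaf
    (fun s hs y hy => antipode_elt_of_lt hσ hs hy) hx, conv_sum, antipode_elt t hx,
    Finset.sum_range_succ', add_comm]
  simp only [conv_convPow hσ]
  rfl

/-- Writing `S` for the antipode and `u` for the unit, the series equation reads `S = u + S - S *
id`, with `*` denoting convolution; cancelling `S` leaves `S * id = u`. -/
theorem antipode_conv_id (hσ : IsBraiding σ) :
    conv σ (antipode σ) LinearMap.id = convUnit k V := by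
  have h := antipode_eq_left hσ
  rw [unitSubId, conv_add_right, conv_smul_right, conv_convUnit hσ] at h
  exact eq_of_eq_add_add_neg h

theorem id_conv_antipode (hσ : IsBraiding σ) :
    conv σ LinearMap.id (antipode σ) = convUnit k V := by
  have h := antipode_eq_right hσ
  rw [unitSubId, conv_add_left, conv_smul_left, convUnit_conv hσ] at h
  exact eq_of_eq_add_add_neg h

end Antipode

end BraidedTree

end

theorem mainTheorem1 {k : Type*} [Field k] [CharZero k] {V : Type*} [AddCommGroup V] [Module k V]
    (σ : V ⊗[k] V →ₗ[k] V ⊗[k] V) (hσ : BraidedTree.IsBraiding σ) :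
    BraidedTree.IsBraidedHopfAlgebra
      (BraidedTree.mul : BraidedTree.TreeSpace k V ⊗[k] BraidedTree.TreeSpace k V →ₗ[k]
        BraidedTree.TreeSpace k V)
      BraidedTree.leaf
      (BraidedTree.comul σ)
      BraidedTree.counit
      (BraidedTree.sigmaBT σ) :=
  -- `rTensor` and `lTensor` are `TensorProduct.map` with an identity factor, so the convolution
  -- identities are the antipode axioms by definition.
  ⟨BraidedTree.isBraidedBialgebra_tree hσ, BraidedTree.antipode σ,
    BraidedTree.antipode_conv_id hσ, BraidedTree.id_conv_antipode hσ⟩
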